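/- Let $m\in\mathbb C$, let $F$ be the Gauss hypergeometric function, and for $0\le r\le\tau$ and real $b$ near $0$ put $$E(r,\tau;b;m)=2^{2im}(1+b)^{2im}\big((\tau+b+2)^2-r^2\big)^{-im}F\Big(im,im;1;\tfrac{(\tau-b)^2-r^2}{(\tau+b+2)^2-r^2}\Big),$$ $$K_1(r,\tau;m)=E(r,\tau;0;m),\qquad K_0(r,\tau;m)=-\partial_bE(r,\tau;b;m)\big|_{b=0}.$$ Let $\Omega\subseteq\mathbb R^n$ be open and $x_0\in\Omega$. Let $\mathcal T$ be a barrelled topological vector space of continuous functions on $\Omega$, with continuous point evaluations, that contains the test functions $\mathcal D(\Omega)$ densely and continuously (for example $\mathcal D(\Omega)$, $C^\infty(\Omega)$, or $\mathcal S(\mathbb R^n)$ if $\Omega=\mathbb R^n$), so that its dual $\mathcal T'$ is a space of distributions on $\Omega$. Let $A=A(x,\partial_x)$ be a pseudo-differential operator on $\Omega$ of any order and type, with a smooth symbol $A(x,\xi)$ which, together with each of its derivatives, grows at most polynomially in $\xi$, locally uniformly in $x\in\Omega$. Assume that $A$ has a transpose $A^t$ which is continuous and linear from $\mathcal D(\Omega)$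 to $\mathcal T$, that is, $\int_\Omega (A\varphi)\psi\,dx=\int_\Omega\varphi\,A^t\psi\,dx$ for all $\varphi,\psi\in\mathcal D(\Omega)$; $A$ then acts from $\mathcal T'$ to $\mathcal D'(\Omega)$ by $\langle Au,\psi\rangle=\langle u,A^t\psi\rangle$. By a solution $u(\cdot,\tau)$, $\tau\ge0$, of a Cauchy problem we mean a family in $\mathcal T'$ that is weakly continuous in $\mathcal T'$ and weakly twice continuously differentiable in $\mathcal D'(\Omega)$ with respect to $\tau\in[0,\infty)$ (one-sided derivatives at $\tau=0$) and satisfies the equation in $\mathcal D'(\Omega)$ for all $\tau\ge 0$. **Theorem.** Let $\mathcal E_A(x,r;x_0)$ be a fundamental solution of the Cauchy problem for $\partial_r^2-A$, that is, a solution of $$\partial_r^2\mathcal E_A-A(x,\partial_x)\mathcal E_A=0,\qquad \mathcal E_A(x,0;x_0)=\delta(x-x_0),\quad \partial_r\mathcal E_A(x,0;x_0)=0 .$$ Then for every $\tau\ge0$ the (weak) integrals in the following formulas exist and define elements of $\mathcal T'$: $$\mathcal E_0(x,\tau;x_0)=(1+\tau)^{-im}\mathcal E_A(x,\tau;x_0)+\int_0^\tau\big[K_0(r,\tau;m)+2im\,K_1(r,\tau;m)\big]\mathcal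 E_A(x,r;x_0)\,dr,$$ $$\mathcal E_1(x,\tau;x_0)=\int_0^\tau K_1(r,\tau;m)\,\mathcal E_A(x,r;x_0)\,dr,$$ and for $i=0,1$ the family $\mathcal E_i$ is a solution of the Cauchy problem for the generalized Euler--Poisson--Darboux equation $$\partial_\tau^2\mathcal E_i-A(x,\partial_x)\mathcal E_i+\frac{2im}{\tau+1}\,\partial_\tau\mathcal E_i=0,\qquad \mathcal E_i(x,0;x_0)=\delta_{i0}\,\delta(x-x_0),\quad \partial_\tau\mathcal E_i(x,0;x_0)=\delta_{i1}\,\delta(x-x_0).$$ -/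

import Mathlib

open Set Filter Topology MeasureTheory TopologicalSpace
open scoped Distributions ContDiff

noncomputable section

namespace EPD

/-! ### Kernel functions -/

/-- The kernel
`E(r,τ;b;m) = 2^{2im} (1+b)^{2im} ((τ+b+2)² - r²)^{-im} F(im, im; 1; ((τ-b)²-r²)/((τ+b+2)²-r²))`,
where `F` is the Gauss hypergeometric function (used only inside its disc of convergence). -/
def kernelE (m : ℂ) (r τ b : ℝ) : ℂ :=
  (2 : ℂ) ^ (2 * Complex.I * m) * ((1 + b : ℝ) : ℂ) ^ (2 * Complex.I * m)
    * (((τ + b + 2) ^ 2 - r ^ 2 : ℝ) : ℂ) ^ (-(Complex.I * m))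
    * ordinaryHypergeometric (Complex.I * m) (Complex.I * m) (1 : ℂ)
        ((((τ - b) ^ 2 - r ^ 2) / ((τ + b + 2) ^ 2 - r ^ 2) : ℝ) : ℂ)

/-- `K₁(r,τ;m) = E(r,τ;0;m)`. -/
def kernelK1 (m : ℂ) (r τ : ℝ) : ℂ := kernelE m r τ 0

/-- `K₀(r,τ;m) = -∂_b E(r,τ;b;m)` at `b = 0`. -/
def kernelK0 (m : ℂ) (r τ : ℝ) : ℂ := -deriv (fun b : ℝ => kernelE m r τ b) 0

/-! ### Distributions -/

/-- `ℝⁿ` with its Euclidean structure. -/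
abbrev Space (n : ℕ) : Type := EuclideanSpace ℝ (Fin n)

/-- Complex distributions on the open set `Ω`: continuous `ℂ`-linear forms on the complex-valued
test functions `𝓓(Ω, ℂ)`. -/
abbrev Distr {n : ℕ} (Ω : Opens (Space n)) : Type := 𝓓(Ω, ℂ) →L[ℂ] ℂ

/-- The Dirac distribution `δ(x - x₀)`. -/
def dirac {n : ℕ} (Ω : Opens (Space n)) (x₀ : Space n) : Distr Ω where
  toFun φ := φ x₀
  map_add' _ _ := rfl
  map_smul' _ _ := rfl
  cont := continuous_eval_const x₀

/-- A topological vector space `T` of continuous functions on `Ω` in which the test functions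
`𝓓(Ω, ℂ)` are densely and continuously included, for example `𝓓(Ω, ℂ)` itself, `C^∞(Ω)`, or the
Schwartz space when `Ω = ℝⁿ`. Its dual `T →L[ℂ] ℂ` is then a space of distributions on `Ω`
(respectively: all distributions, the compactly supported ones, the tempered ones). -/
structure TestSpace {n : ℕ} (Ω : Opens (Space n)) (T : Type*)
    [AddCommGroup T] [Module ℂ T] [TopologicalSpace T] where
  /-- The function represented by an element of `T`; only its values on `Ω` are meaningful. -/
  toFun : T →ₗ[ℂ] (Space n → ℂ)
  /-- The inclusion of the test functions. -/
  incl : 𝓓(Ω, ℂ) →L[ℂ] T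
  toFun_incl : ∀ φ : 𝓓(Ω, ℂ), ∀ x ∈ Ω, toFun (incl φ) x = φ x
  denseRange_incl : DenseRange incl
  continuousOn_toFun : ∀ f : T, ContinuousOn (toFun f) Ω
  continuous_eval : ∀ x ∈ Ω, Continuous fun f : T => toFun f x
  eq_zero_of_toFun : ∀ f : T, (∀ x ∈ Ω, toFun f x = 0) → f = 0

/-- An element of the dual of `T`, viewed as a distribution on `Ω`. -/
def TestSpace.toDistr {n : ℕ} {Ω : Opens (Space n)} {T : Type*}
    [AddCommGroup T] [Module ℂ T] [TopologicalSpace T] (S : TestSpace Ω T)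
    (u : T →L[ℂ] ℂ) : Distr Ω :=
  u.comp S.incl

/-! ### Pseudo-differential operators -/

/-- Symbols on `Ω × ℝⁿ`: smooth functions `a(x,ξ)` which, together with each of their derivatives,
grow at most polynomially in `ξ`, locally uniformly in `x`. This contains all symbols of every
order and every type `(ρ,δ)`. -/
def IsSymbol {n : ℕ} (Ω : Opens (Space n)) (a : Space n → Space n → ℂ) : Prop :=
  ContDiffOn ℝ ∞ (fun p : Space n × Space n => a p.1 p.2) ((Ω : Set (Space n)) ×ˢ univ) ∧
  ∀ K : Set (Space n), IsCompact K → K ⊆ Ω → ∀ k : ℕ, ∃ C N : ℝ, ∀ x ∈ K, ∀ ξ : Space n,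
    ‖iteratedFDeriv ℝ k (fun p : Space n × Space n => a p.1 p.2) (x, ξ)‖ ≤ C * (1 + ‖ξ‖) ^ N

/-- The function `a(x,∂_x) φ`, that is
`(2π)⁻ⁿ ∫ e^{i⟨x,ξ⟩} a(x,ξ) φ̂(ξ) dξ` with `φ̂(ξ) = ∫ e^{-i⟨y,ξ⟩} φ(y) dy`. -/
def quantize {n : ℕ} (a : Space n → Space n → ℂ) (φ : Space n → ℂ) (x : Space n) : ℂ :=
  (((2 * Real.pi) ^ n : ℝ) : ℂ)⁻¹ *
    ∫ ξ : Space n, Complex.exp (Complex.I * ((inner ℝ x ξ : ℝ) : ℂ)) * a x ξ *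
      ∫ y : Space n, Complex.exp (-(Complex.I * ((inner ℝ y ξ : ℝ) : ℂ))) * φ y

/-- `At` is the transpose of the pseudo-differential operator with symbol `a`, mapping test
functions into `T`:  `∫ (a(x,∂_x) φ) ψ dx = ∫ φ (At ψ) dx` for all test functions `φ`, `ψ`.
There is at most one such `At`. -/
def IsTranspose {n : ℕ} {Ω : Opens (Space n)} {T : Type*}
    [AddCommGroup T] [Module ℂ T] [TopologicalSpace T] (S : TestSpace Ω T)
    (a : Space n → Space n → ℂ) (At : 𝓓(Ω, ℂ) →L[ℂ] T) : Prop :=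
  ∀ φ ψ : 𝓓(Ω, ℂ),
    ∫ x in (Ω : Set (Space n)), quantize a φ x * ψ x =
      ∫ y in (Ω : Set (Space n)), φ y * S.toFun (At ψ) y

/-- The pseudo-differential operator `A = a(x,∂_x)` with transpose `At`, acting by duality on the
distributions that belong to the dual of `T`:  `⟨A u, ψ⟩ = ⟨u, At ψ⟩`. -/
def applyOp {n : ℕ} {Ω : Opens (Space n)} {T : Type*}
    [AddCommGroup T] [Module ℂ T] [TopologicalSpace T]
    (At : 𝓓(Ω, ℂ) →L[ℂ] T) (u : T →L[ℂ] ℂ) : Distr Ω :=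
  u.comp At

/-! ### The Cauchy problem -/

/-- The family `u(·,τ)`, `τ ≥ 0`, of distributions solves the Cauchy problem
`∂_τ² u - A u + c(τ) ∂_τ u = 0` for `τ ≥ 0`, `u(·,0) = g₀`, `∂_τ u(·,0) = g₁`.
It is (weakly) continuous in the dual of `T`, on which `A` acts, and (weakly) twice
continuously differentiable as a distribution on `Ω`; derivatives at `τ = 0` are one-sided. -/
structure SolvesCauchy {n : ℕ} {Ω : Opens (Space n)} {T : Type*}
    [AddCommGroup T] [Module ℂ T] [TopologicalSpace T] (S : TestSpace Ω T)
    (At : 𝓓(Ω, ℂ) →L[ℂ] T) (c : ℝ → ℂ) (g₀ g₁ : Distr Ω) (u : ℝ → T →L[ℂ] ℂ) : Prop where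
  continuousOn : ∀ f : T, ContinuousOn (fun τ => u τ f) (Ici 0)
  contDiffOn : ∀ φ : 𝓓(Ω, ℂ), ContDiffOn ℝ 2 (fun τ => S.toDistr (u τ) φ) (Ici 0)
  equation : ∀ φ : 𝓓(Ω, ℂ), ∀ τ : ℝ, 0 ≤ τ →
    iteratedDerivWithin 2 (fun s => S.toDistr (u s) φ) (Ici 0) τ - applyOp At (u τ) φ
      + c τ * derivWithin (fun s => S.toDistr (u s) φ) (Ici 0) τ = 0
  initial : S.toDistr (u 0) = g₀
  initial_deriv : ∀ φ : 𝓓(Ω, ℂ),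
    derivWithin (fun s => S.toDistr (u s) φ) (Ici 0) 0 = g₁ φ

/-- `w = ∫₀^τ k(r) u(r) dr` in the dual of `T`, as a weak integral. -/
def IsWeakIntegral {T : Type*} [AddCommGroup T] [Module ℂ T] [TopologicalSpace T]
    (k : ℝ → ℂ) (u : ℝ → T →L[ℂ] ℂ) (τ : ℝ) (w : T →L[ℂ] ℂ) : Prop :=
  ∀ f : T, IntervalIntegrable (fun r => k r * u r f) volume 0 τ ∧
    w f = ∫ r in (0 : ℝ)..τ, k r * u r f

end EPD

end

/-! Write `c(τ) = 2im/(τ+1)`. For each fixed `b` the kernel `E` solves `E_ττ + c E_τ = E_rr`: with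
`z = p/q` the argument of `F`, the equation reduces to a multiple of the Gauss equation for `F(im,
im; 1; z)`. The operator is linear and does not involve `b`, so `∂_b E` solves it too, and hence so
do `K₁` and `K₀ + 2im K₁`. All are even in `r`, so `K_r = 0` at `r = 0`.

Test the wave solution against `φ`: `V(r) = ⟨ℰ_A(r), φ⟩` satisfies `V'' = ⟨ℰ_A, Aᵗφ⟩` and `V'(0) =
0`. Differentiate `J(τ) = ∫₀^τ K(r,τ) V(r) dr` twice, use the kernel equation, and integrate by
parts twice in `r`. The boundary terms at `0` vanish, and with `k(τ) = K(τ,τ)` one gets `J'' + c J'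
- ∫₀^τ K V'' dr = (2k' + c k) V(τ)` (`IsEPDKernel.hasDerivAt_deriv_volterra`). The integral on the
left is the weak integral tested at `Aᵗφ`. This is why the weak integral must lie in the dual of
`T`, which barrelledness provides (`exists_isWeakIntegral`).

Only diagonal values remain to be found. For `K₁`, `k = a := (1+τ)^(-im)` and `2a' + c a = 0`. For
`K₀ + 2im K₁`, the defect `2k' + c k` cancels the term `a'' + c a'` produced by `aV`, while `2a' + c
a = 0` removes the `V'` term. -/

namespace EPD

/-! ### The Gauss equation, from power series. -/

/-- A power series converging on the unit disc may be differentiated termwise. -/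
theorem hasSum_deriv_of_hasSum_pow {c : ℕ → ℂ} {f : ℂ → ℂ}
    (h : ∀ z : ℂ, ‖z‖ < 1 → HasSum (fun n => c n * z ^ n) (f z)) {z : ℂ} (hz : ‖z‖ < 1) :
    HasDerivAt f (deriv f z) z ∧
      HasSum (fun n : ℕ => ((n : ℂ) + 1) * c (n + 1) * z ^ n) (deriv f z) := by
  have hball : HasFPowerSeriesOnBall f (FormalMultilinearSeries.ofScalars ℂ c) 0 1 := by
    refine ⟨?_, one_pos, ?_⟩
    · refine ENNReal.le_of_forall_nnreal_lt fun r hr => ?_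
      apply FormalMultilinearSeries.le_radius_of_summable
      have hr1 : ‖((r : ℝ) : ℂ)‖ < 1 := by
        have : (r : ℝ) < 1 := by exact_mod_cast hr
        simpa using this
      have := (h _ hr1).summable.norm
      refine this.congr fun n => ?_
      simp
    · intro y hy
      have hy1 : ‖y‖ < 1 := by
        rw [mem_eball_zero_iff] at hy
        simpa [enorm, ← NNReal.coe_lt_coe] using hy
      have := h y hy1
      simpa [FormalMultilinearSeries.ofScalars_apply_eq, mul_comm] using this
  have hmem : z ∈ Metric.eball (0 : ℂ) 1 := by
    rw [mem_eball_zero_iff]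
    simpa [enorm, ← NNReal.coe_lt_coe] using hz
  have hd := hball.differentiableOn.differentiableAt (Metric.isOpen_eball.mem_nhds hmem)
  refine ⟨hd.hasDerivAt, ?_⟩
  have hs := (hball.fderiv.hasSum hmem).mapL (ContinuousLinearMap.apply ℂ ℂ (1 : ℂ))
  rw [zero_add] at hs
  have e : (ContinuousLinearMap.apply ℂ ℂ (1 : ℂ)) (fderiv ℂ f z) = deriv f z := by simp
  rw [e] at hs
  convert! hs using 1
  funext n
  have h1 : FormalMultilinearSeries.derivSeries (.ofScalars ℂ c) n (fun _ => z) =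
      z ^ n • (FormalMultilinearSeries.derivSeries (.ofScalars ℂ c)).coeff n := by
    rw [FormalMultilinearSeries.apply_eq_pow_smul_coeff]
  rw [h1]
  simp [FormalMultilinearSeries.derivSeries_coeff_one]
  ring

theorem hasSum_mul_of_hasSum_succ {d : ℕ → ℂ} {z s : ℂ}
    (h : HasSum (fun n : ℕ => ((n : ℂ) + 1) * d (n + 1) * z ^ n) s) :
    HasSum (fun n : ℕ => (n : ℂ) * d n * z ^ n) (z * s) := by
  rw [← hasSum_nat_add_iff' 1]
  simp only [Finset.range_one, Finset.sum_singleton, Nat.cast_zero, zero_mul, sub_zero]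
  convert! h.mul_left z using 1
  funext n
  push_cast
  ring

/-- The Gauss hypergeometric equation for `F(μ, μ; 1; ·)` in the unit disc. -/
theorem hypergeometric_ode (μ : ℂ) {z : ℂ} (hz : ‖z‖ < 1) :
    HasDerivAt (ordinaryHypergeometric (𝔸 := ℂ) μ μ (1 : ℂ))
      (deriv (ordinaryHypergeometric (𝔸 := ℂ) μ μ (1 : ℂ)) z) z ∧
    HasDerivAt (deriv (ordinaryHypergeometric (𝔸 := ℂ) μ μ (1 : ℂ)))
      (deriv (deriv (ordinaryHypergeometric (𝔸 := ℂ) μ μ (1 : ℂ))) z) z ∧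
    z * (1 - z) * deriv (deriv (ordinaryHypergeometric (𝔸 := ℂ) μ μ (1 : ℂ))) z
      + (1 - (2 * μ + 1) * z) * deriv (ordinaryHypergeometric (𝔸 := ℂ) μ μ (1 : ℂ)) z
      - μ ^ 2 * ordinaryHypergeometric (𝔸 := ℂ) μ μ (1 : ℂ) z = 0 := by
  set F := ordinaryHypergeometric (𝔸 := ℂ) μ μ (1 : ℂ) with hF
  set c := ordinaryHypergeometricCoefficient μ μ (1 : ℂ) with hc
  -- This recurrence is the differential equation read off at the coefficient of `z ^ n`.
  have hrec (n : ℕ) : ((n : ℂ) + 1) ^ 2 * c (n + 1) = (n + μ) ^ 2 * c n := by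
    have h1 : ((n.factorial : ℕ) : ℂ) ≠ 0 := by exact_mod_cast n.factorial_ne_zero
    have h2 : (1 : ℂ) + n ≠ 0 := by rw [add_comm]; exact_mod_cast n.succ_ne_zero
    simp only [hc, ordinaryHypergeometricCoefficient, ascPochhammer_succ_eval,
      Nat.factorial_succ, ascPochhammer_eval_one]
    push_cast
    field_simp
    ring
  have h0 (w : ℂ) (hw : ‖w‖ < 1) : HasSum (fun n => c n * w ^ n) (F w) := by
    have hr : 1 ≤ (ordinaryHypergeometricSeries ℂ μ μ (1 : ℂ)).radius := by
      -- The regularization divides by `Γ(1) = 1`, so both series coincide; the bound covers every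
      -- `μ`, including those for which the series terminates.
      have := Complex.radius_regularizedGaussHGFunSeries_ge_one μ μ 1
      convert! this using 2
      refine FormalMultilinearSeries.ext fun j => ?_
      refine ContinuousMultilinearMap.ext fun v => ?_
      rw [FormalMultilinearSeries.apply_eq_prod_smul_coeff,
        FormalMultilinearSeries.apply_eq_prod_smul_coeff]
      congr 1
      have hk : ∀ k : ℕ, (1 : ℂ) ≠ -k := fun k h => by
        have := congrArg Complex.re h
        simp at this
        linarith [(Nat.cast_nonneg k : (0:ℝ) ≤ k)]
      have := Complex.Gamma_inv_mul_ordinaryHypergeometricSeries_eq (a := μ) (b := μ) hk (n := j)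
      simpa using this
    have hw' : w ∈ Metric.eball (0 : ℂ) (ordinaryHypergeometricSeries ℂ μ μ (1 : ℂ)).radius := by
      refine Metric.eball_subset_eball hr ?_
      rw [mem_eball_zero_iff]
      simpa [enorm, ← NNReal.coe_lt_coe] using hw
    have := FormalMultilinearSeries.hasSum _ hw'
    simp only [ordinaryHypergeometricSeries_apply_eq, smul_eq_mul] at this
    exact this
  have h1 (w : ℂ) (hw : ‖w‖ < 1) := hasSum_deriv_of_hasSum_pow h0 hw
  have h2 (w : ℂ) (hw : ‖w‖ < 1) :=
    hasSum_deriv_of_hasSum_pow (c := fun n => ((n : ℂ) + 1) * c (n + 1)) (fun v hv => (h1 v hv).2) hw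
  refine ⟨(h1 z hz).1, (h2 z hz).1, ?_⟩
  have s0 := h0 z hz
  have s1 := (h1 z hz).2
  have zs1 := hasSum_mul_of_hasSum_succ s1
  have zs2 := hasSum_mul_of_hasSum_succ (d := fun n => ((n : ℂ) + 1) * c (n + 1)) (h2 z hz).2
  -- The factor `n - 1` gives the series `∑ n (n - 1) c n z ^ n` of `z² F''`.
  have zzs2 := hasSum_mul_of_hasSum_succ (d := fun n => ((n : ℂ) - 1) * c n)
    (z := z) (s := z * deriv (deriv F) z) (by
      convert! zs2 using 1
      funext n
      push_cast
      ring)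
  have tot := ((((zs2.sub zzs2).add s1).sub (zs1.mul_left (2 * μ + 1))).sub (s0.mul_left (μ ^ 2)))
  have hz0 := tot.unique (a₂ := 0) (by
    convert! hasSum_zero using 1
    funext n
    linear_combination z ^ n * hrec n)
  linear_combination hz0

/-! ### The Euler-Poisson-Darboux equation for `E`. -/

/-- `q ^ (-ν) * f (p / q)`, homogeneous of degree `-ν` in `(p, q)`. -/
noncomputable def homog (ν : ℂ) (f : ℂ → ℂ) (p q : ℝ) : ℂ := (q : ℂ) ^ (-ν) * f ((p / q : ℝ) : ℂ)

theorem ofReal_cpow_neg_eq_mul {q : ℝ} (hq : 0 < q) (ν : ℂ) :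
    (q : ℂ) ^ (-ν) = q * (q : ℂ) ^ (-(ν + 1)) := by
  have h : (q : ℂ) ≠ 0 := by exact_mod_cast hq.ne'
  rw [show -ν = 1 + -(ν + 1) by ring, Complex.cpow_add _ _ h, Complex.cpow_one]

/-- Partial derivatives of a function homogeneous of degree `-ν` are homogeneous of degree `-(ν+1)`:
the profile `f` becomes `f'` under `∂_p` and `-ν f - z f'` under `∂_q`. The same shape reappears, so
the rule can be iterated. -/
theorem HasDerivAt.homog {ν : ℂ} {f : ℂ → ℂ} {f' : ℂ} {p q : ℝ → ℝ} {p' q' x : ℝ}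
    (hf : HasDerivAt f f' ((p x / q x : ℝ) : ℂ)) (hp : HasDerivAt p p' x) (hq : HasDerivAt q q' x)
    (hq0 : 0 < q x) :
    HasDerivAt (fun y => homog ν f (p y) (q y))
      ((q x : ℂ) ^ (-(ν + 1)) *
        (p' * f' + q' * (-ν * f ((p x / q x : ℝ) : ℂ) - ((p x / q x : ℝ) : ℂ) * f'))) x := by
  have h : (q x : ℂ) ≠ 0 := by exact_mod_cast hq0.ne'
  have h1 : HasDerivAt (fun y => (q y : ℂ) ^ (-ν)) (-ν * (q x : ℂ) ^ (-ν - 1) * q') x :=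
    ((((hasDerivAt_id (q x : ℂ)).cpow_const (c := -ν) (Or.inl (by simpa using hq0))).comp_of_eq x
      hq.ofReal_comp rfl)).congr_deriv (by simp)
  have h2 := hf.comp_of_eq x (hp.div hq hq0.ne').ofReal_comp rfl
  have h3 := h1.mul h2
  refine (h3.congr_deriv ?_)
  simp only [Function.comp_apply, Pi.div_apply]
  rw [ofReal_cpow_neg_eq_mul hq0, show -ν - 1 = -(ν + 1) by ring]
  push_cast
  field_simp
  ring

/-- The domain of smoothness of the kernel `E`, in the variables `(r, τ, b)`. -/
def kernelDomain : Set (ℝ × ℝ × ℝ) :=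
  {p | -1 < p.2.1 ∧ -1 < p.2.2 ∧ p.1 ^ 2 < (p.2.1 + 1) ^ 2 + (p.2.2 + 1) ^ 2}

theorem isOpen_kernelDomain : IsOpen kernelDomain :=
  (isOpen_lt (f := fun _ : ℝ × ℝ × ℝ => (-1 : ℝ)) (g := fun p => p.2.1)
    (by fun_prop) (by fun_prop)).inter
    ((isOpen_lt (f := fun _ : ℝ × ℝ × ℝ => (-1 : ℝ)) (g := fun p => p.2.2)
      (by fun_prop) (by fun_prop)).inter
      (isOpen_lt (f := fun p : ℝ × ℝ × ℝ => p.1 ^ 2)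
        (g := fun p => (p.2.1 + 1) ^ 2 + (p.2.2 + 1) ^ 2) (by fun_prop) (by fun_prop)))

theorem kernelDomain_denom_pos {r τ b : ℝ} (h : (r, τ, b) ∈ kernelDomain) :
    0 < (τ + b + 2) ^ 2 - r ^ 2 := by
  obtain ⟨h1, h2, h3⟩ := h
  simp only at h1 h2 h3
  nlinarith [mul_pos (show 0 < τ + 1 by linarith) (show 0 < b + 1 by linarith)]

/-- With `s = τ + 1` and `t = b + 1`, the bound `z < 1` amounts to `s t > 0` and `z > -1` to `r² <
s² + t²`, which explains the shape of `kernelDomain`. -/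
theorem kernelDomain_abs_lt {r τ b : ℝ} (h : (r, τ, b) ∈ kernelDomain) :
    ‖((((τ - b) ^ 2 - r ^ 2) / ((τ + b + 2) ^ 2 - r ^ 2) : ℝ) : ℂ)‖ < 1 := by
  have h0 := kernelDomain_denom_pos h
  obtain ⟨h1, h2, h3⟩ := h
  simp only at h1 h2 h3
  rw [Complex.norm_real, Real.norm_eq_abs, abs_lt, lt_div_iff₀ h0, div_lt_iff₀ h0]
  constructor <;>
  nlinarith [mul_pos (show 0 < τ + 1 by linarith) (show 0 < b + 1 by linarith)]

theorem kernelE_eq_homog (m : ℂ) (r τ b : ℝ) :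
    kernelE m r τ b = (2 : ℂ) ^ (2 * Complex.I * m) * ((1 + b : ℝ) : ℂ) ^ (2 * Complex.I * m) *
      homog (Complex.I * m) (ordinaryHypergeometric (Complex.I * m) (Complex.I * m) (1 : ℂ))
        ((τ - b) ^ 2 - r ^ 2) ((τ + b + 2) ^ 2 - r ^ 2) := by
  simp only [kernelE, homog]
  ring

/-- The two derivatives of `homog μ F` along a curve `(p, q)`, where `F = F(μ, μ; 1; ·)`. -/
theorem hasDerivAt_homog_hypergeometric (μ : ℂ) {p q p' q' : ℝ → ℝ} {p'' q'' x : ℝ}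
    (hp : ∀ y, HasDerivAt p (p' y) y) (hq : ∀ y, HasDerivAt q (q' y) y)
    (hp' : HasDerivAt p' p'' x) (hq' : HasDerivAt q' q'' x)
    (hq0 : 0 < q x) (hz : ‖((p x / q x : ℝ) : ℂ)‖ < 1) :
    let F := ordinaryHypergeometric (𝔸 := ℂ) μ μ (1 : ℂ)
    let B : ℂ → ℂ := fun z => -μ * F z - z * deriv F z
    let B' : ℂ → ℂ := fun z => -(μ + 1) * deriv F z - z * deriv (deriv F) z
    let z : ℂ := ((p x / q x : ℝ) : ℂ)
    HasDerivAt (fun y => homog μ F (p y) (q y))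
      (p' x * homog (μ + 1) (deriv F) (p x) (q x) + q' x * homog (μ + 1) B (p x) (q x)) x ∧
    HasDerivAt (fun y =>
      p' y * homog (μ + 1) (deriv F) (p y) (q y) + q' y * homog (μ + 1) B (p y) (q y))
      ((q x : ℂ) ^ (-(μ + 1 + 1)) * (q x * (p'' * deriv F z + q'' * B z) +
        p' x * (p' x * deriv (deriv F) z + q' x * B' z) +
        q' x * (p' x * B' z + q' x * (-(μ + 1) * B z - z * B' z)))) x := by
  intro F B B' z
  obtain ⟨h1, h2, -⟩ := hypergeometric_ode μ hz
  have hB : HasDerivAt B (B' z) z :=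
    ((h1.const_mul (-μ)).sub ((hasDerivAt_id _).mul h2)).congr_deriv (by simp [B', z, F]; ring)
  constructor
  · refine (HasDerivAt.homog (ν := μ) h1 (hp x) (hq x) hq0).congr_deriv ?_
    simp only [EPD.homog, B, F]
    ring
  · have a1 := HasDerivAt.homog (ν := μ + 1) h2 (hp x) (hq x) hq0
    have a2 := HasDerivAt.homog (ν := μ + 1) hB (hp x) (hq x) hq0
    refine ((hp'.ofReal_comp.mul a1).add (hq'.ofReal_comp.mul a2)).congr_deriv ?_
    simp only [EPD.homog]
    rw [ofReal_cpow_neg_eq_mul hq0 (μ + 1)]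
    simp only [B', z, F]
    ring

/-- The kernel `E` solves the Euler-Poisson-Darboux equation in `(r, τ)`. -/
theorem kernelE_hasDerivAt (m : ℂ) : ∃ et er : ℝ → ℝ → ℝ → ℂ, ∀ r τ b : ℝ,
    (r, τ, b) ∈ kernelDomain → ∃ ett err : ℂ,
    HasDerivAt (fun t => kernelE m r t b) (et r τ b) τ ∧
    HasDerivAt (fun t => et r t b) ett τ ∧
    HasDerivAt (fun s => kernelE m s τ b) (er r τ b) r ∧
    HasDerivAt (fun s => er s τ b) err r ∧
    ett + 2 * Complex.I * m / ((τ + 1 : ℝ) : ℂ) * et r τ b - err = 0 := by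
  set μ := Complex.I * m with hμ
  set F := ordinaryHypergeometric (𝔸 := ℂ) μ μ (1 : ℂ) with hF
  set C : ℝ → ℂ := fun b =>
    (2 : ℂ) ^ (2 * Complex.I * m) * ((1 + b : ℝ) : ℂ) ^ (2 * Complex.I * m) with hC
  set B : ℂ → ℂ := fun z => -μ * F z - z * deriv F z
  set D1 : ℝ → ℝ → ℝ → ℂ := fun r τ b =>
    homog (μ + 1) (deriv F) ((τ - b) ^ 2 - r ^ 2) ((τ + b + 2) ^ 2 - r ^ 2) with hD1
  set D2 : ℝ → ℝ → ℝ → ℂ := fun r τ b =>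
    homog (μ + 1) B ((τ - b) ^ 2 - r ^ 2) ((τ + b + 2) ^ 2 - r ^ 2) with hD2
  refine ⟨fun r τ b => C b * (((2 * (τ - b) : ℝ) : ℂ) * D1 r τ b +
      ((2 * (τ + b + 2) : ℝ) : ℂ) * D2 r τ b),
    fun r τ b => C b * (((-2 * r : ℝ) : ℂ) * D1 r τ b + ((-2 * r : ℝ) : ℂ) * D2 r τ b), ?_⟩
  intro r τ b h
  have hq0 := kernelDomain_denom_pos h
  have hz := kernelDomain_abs_lt h
  obtain ⟨t1, t2⟩ := hasDerivAt_homog_hypergeometric μ (x := τ)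
    (p := fun t => (t - b) ^ 2 - r ^ 2) (q := fun t => (t + b + 2) ^ 2 - r ^ 2)
    (p' := fun t => 2 * (t - b)) (q' := fun t => 2 * (t + b + 2)) (p'' := 2) (q'' := 2)
    (fun y => ((((hasDerivAt_id y).sub_const b).pow 2).sub_const _).congr_deriv (by simp))
    (fun y => (((((hasDerivAt_id y).add_const b).add_const 2).pow 2).sub_const _).congr_deriv
      (by simp))
    ((((hasDerivAt_id τ).sub_const b).const_mul 2).congr_deriv (by simp))
    (((((hasDerivAt_id τ).add_const b).add_const 2).const_mul 2).congr_deriv (by simp)) hq0 hz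
  obtain ⟨r1, r2⟩ := hasDerivAt_homog_hypergeometric μ (x := r)
    (p := fun s => (τ - b) ^ 2 - s ^ 2) (q := fun s => (τ + b + 2) ^ 2 - s ^ 2)
    (p' := fun s => -2 * s) (q' := fun s => -2 * s) (p'' := -2) (q'' := -2)
    (fun y => (((hasDerivAt_id y).pow 2).const_sub _).congr_deriv (by simp))
    (fun y => (((hasDerivAt_id y).pow 2).const_sub _).congr_deriv (by simp))
    (((hasDerivAt_id r).const_mul (-2)).congr_deriv (by simp))
    (((hasDerivAt_id r).const_mul (-2)).congr_deriv (by simp)) hq0 hz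
  refine ⟨_, _, ?_, t2.const_mul (C b), ?_, r2.const_mul (C b), ?_⟩
  · simp only [kernelE_eq_homog]
    exact t1.const_mul (C b)
  · simp only [kernelE_eq_homog]
    exact r1.const_mul (C b)
  · have ode := (hypergeometric_ode μ hz).2.2
    have hs : ((τ : ℂ) + 1) ≠ 0 := by
      have : (0 : ℝ) < τ + 1 := by linarith [h.1]
      exact_mod_cast this.ne'
    have hX : (((((τ - b) ^ 2 - r ^ 2) / ((τ + b + 2) ^ 2 - r ^ 2) : ℝ)) : ℂ) *
        (((τ : ℂ) + b + 2) ^ 2 - r ^ 2) = ((τ : ℂ) - b) ^ 2 - r ^ 2 := by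
      exact_mod_cast div_mul_cancel₀ _ hq0.ne'
    simp only [hD1, hD2, homog]
    rw [ofReal_cpow_neg_eq_mul hq0 (μ + 1)]
    generalize (((((τ - b) ^ 2 - r ^ 2) / ((τ + b + 2) ^ 2 - r ^ 2) : ℝ)) : ℂ) = z at *
    generalize ((((τ + b + 2) ^ 2 - r ^ 2 : ℝ)) : ℂ) ^ (-(μ + 1 + 1)) = R at *
    have e : 2 * Complex.I * m = 2 * μ := by rw [hμ]; ring
    rw [e]
    generalize C b = c
    simp only [B, ← hF] at *
    generalize deriv (deriv F) z = F2 at *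
    generalize deriv F z = F1 at *
    generalize F z = F0 at *
    push_cast
    apply mul_left_cancel₀ hs
    field_simp
    -- Modulo `z q = p` (this is `hX`), `τ + 1` times the EPD expression is `4 (b + 1) c R q` times
    -- the Gauss equation.
    linear_combination (4 * c * R * (b + 1) * (((τ : ℂ) + b + 2) ^ 2 - r ^ 2)) * ode -
      c * R * (4 * (τ + 1) * (F2 + (-(μ + 1) * F1 - z * F2)) +
        4 * (b + 1) * (-(μ + 1) * F1 - z * F2)) * hX

/-! ### Smoothness of the kernel. -/

theorem contDiffAt_ofReal_cpow {E : Type*} [NormedAddCommGroup E] [NormedSpace ℝ E] {f : E → ℝ}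
    {x : E} {n : ℕ∞ω} (hf : ContDiffAt ℝ n f x) (h0 : 0 < f x) (c : ℂ) :
    ContDiffAt ℝ n (fun y => ((f y : ℝ) : ℂ) ^ c) x := by
  have h : ContDiffAt ℝ n (fun y => Complex.exp (((Real.log (f y) : ℝ) : ℂ) * c)) x :=
    (((Complex.ofRealCLM.contDiff.contDiffAt).comp x (hf.log h0.ne')).mul contDiffAt_const).cexp
  refine h.congr_of_eventuallyEq ?_
  filter_upwards [hf.continuousAt.eventually (lt_mem_nhds h0)] with y hy
  rw [Complex.cpow_def_of_ne_zero (by exact_mod_cast hy.ne'), Complex.ofReal_log hy.le]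

theorem contDiffAt_hypergeometric (μ : ℂ) {z : ℂ} (hz : ‖z‖ < 1) {n : ℕ∞ω} :
    ContDiffAt ℝ n (ordinaryHypergeometric (𝔸 := ℂ) μ μ (1 : ℂ)) z := by
  have h : DifferentiableOn ℂ (ordinaryHypergeometric (𝔸 := ℂ) μ μ (1 : ℂ)) (Metric.ball 0 1) :=
    fun w hw => (hypergeometric_ode μ (by simpa using hw)).1.differentiableAt.differentiableWithinAt
  have hz' : z ∈ Metric.ball (0 : ℂ) 1 := by simpa using hz
  have := (h.contDiffOn (n := n) Metric.isOpen_ball).contDiffAt (Metric.isOpen_ball.mem_nhds hz')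
  exact this.restrict_scalars ℝ

theorem contDiffOn_kernelE (m : ℂ) :
    ContDiffOn ℝ ∞ (fun p : ℝ × ℝ × ℝ => kernelE m p.1 p.2.1 p.2.2) kernelDomain := by
  rintro ⟨r, τ, b⟩ h
  have hq0 := kernelDomain_denom_pos h
  have hz := kernelDomain_abs_lt h
  apply ContDiffAt.contDiffWithinAt
  unfold kernelE
  have h1 : ContDiffAt ℝ ∞ (fun p : ℝ × ℝ × ℝ =>
      ((p.2.1 - p.2.2) ^ 2 - p.1 ^ 2) / ((p.2.1 + p.2.2 + 2) ^ 2 - p.1 ^ 2)) (r, τ, b) :=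
    ContDiffAt.div (by fun_prop) (by fun_prop) hq0.ne'
  have h2 : ContDiffAt ℝ ∞ (fun p : ℝ × ℝ × ℝ => 1 + p.2.2) (r, τ, b) := by fun_prop
  have h3 : ContDiffAt ℝ ∞ (fun p : ℝ × ℝ × ℝ => (p.2.1 + p.2.2 + 2) ^ 2 - p.1 ^ 2) (r, τ, b) := by
    fun_prop
  have h4 : 0 < 1 + b := by linarith [h.2.1]
  refine ((contDiffAt_const.mul (contDiffAt_ofReal_cpow h2 h4 _)).mul
    (contDiffAt_ofReal_cpow h3 hq0 _)).mul ?_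
  · exact (contDiffAt_hypergeometric _ hz).comp (r, τ, b)
      ((Complex.ofRealCLM.contDiff.contDiffAt).comp _ h1)

/-! ### Smooth even solutions and their stability under `∂_b`. -/

/-- The derivative of `G` in the direction `v`. -/
noncomputable def dirDeriv {V : Type*} [NormedAddCommGroup V] [NormedSpace ℝ V] (v : V)
    (G : V → ℂ) (p : V) : ℂ := fderiv ℝ G p v

section dirDeriv

variable {V : Type*} [NormedAddCommGroup V] [NormedSpace ℝ V] {D : Set V} {G H : V → ℂ}

theorem contDiffOn_dirDeriv (hD : IsOpen D) (hG : ContDiffOn ℝ ∞ G D) (v : V) :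
    ContDiffOn ℝ ∞ (dirDeriv v G) D :=
  (hG.fderiv_of_isOpen hD (m := ∞) (by simp)).clm_apply contDiffOn_const

theorem dirDeriv_congr (hD : IsOpen D) (h : EqOn G H D) (v : V) :
    EqOn (dirDeriv v G) (dirDeriv v H) D := fun p hp => by
  simp only [dirDeriv]
  rw [(h.eventuallyEq_of_mem (hD.mem_nhds hp)).fderiv_eq]

theorem differentiableAt_of_contDiffOn (hD : IsOpen D) (hG : ContDiffOn ℝ ∞ G D) {p : V}
    (hp : p ∈ D) : DifferentiableAt ℝ G p :=
  (hG.contDiffAt (hD.mem_nhds hp)).differentiableAt (by simp)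

theorem dirDeriv_comm (hD : IsOpen D) (hG : ContDiffOn ℝ ∞ G D) (v w : V) :
    EqOn (dirDeriv v (dirDeriv w G)) (dirDeriv w (dirDeriv v G)) D := fun p hp => by
  have hc := hG.contDiffAt (hD.mem_nhds hp)
  have hd : DifferentiableAt ℝ (fderiv ℝ G) p :=
    (hc.fderiv_right (m := 1) (by norm_cast)).differentiableAt (by simp)
  have e (a b : V) : dirDeriv a (dirDeriv b G) p = fderiv ℝ (fderiv ℝ G) p a b := by
    have : HasFDerivAt (dirDeriv b G)
      ((ContinuousLinearMap.apply ℝ ℂ b).comp (fderiv ℝ (fderiv ℝ G) p)) p :=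
      (ContinuousLinearMap.apply ℝ ℂ b).hasFDerivAt.comp p hd.hasFDerivAt
    rw [dirDeriv, this.fderiv]
    rfl
  rw [e, e]
  exact hc.isSymmSndFDerivAt (by rw [minSmoothness_of_isRCLikeNormedField]; norm_cast) v w

theorem hasDerivAt_comp_line (hD : IsOpen D) (hG : ContDiffOn ℝ ∞ G D) {γ : ℝ → V} {v : V} {t : ℝ}
    (hγ : HasDerivAt γ v t) (ht : γ t ∈ D) :
    HasDerivAt (fun s => G (γ s)) (dirDeriv v G (γ t)) t :=
  (differentiableAt_of_contDiffOn hD hG ht).hasFDerivAt.comp_hasDerivAt t hγ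

theorem dirDeriv_add_smul (hD : IsOpen D) (hG : ContDiffOn ℝ ∞ G D) (hH : ContDiffOn ℝ ∞ H D)
    (c : ℂ) (v : V) :
    EqOn (dirDeriv v (fun p => G p + c * H p)) (fun p => dirDeriv v G p + c * dirDeriv v H p) D :=
  fun p hp => by
    have h1 := differentiableAt_of_contDiffOn hD hG hp
    have h2 := differentiableAt_of_contDiffOn hD hH hp
    simp only [dirDeriv]
    rw [fderiv_fun_add h1 (h2.const_mul c), fderiv_const_mul h2]
    simp

end dirDeriv

theorem hasDerivAt_line_r (r τ b : ℝ) :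
    HasDerivAt (fun s : ℝ => (s, τ, b)) ((1, 0, 0) : ℝ × ℝ × ℝ) r :=
  (hasDerivAt_id r).prodMk (hasDerivAt_const r (τ, b))

theorem hasDerivAt_line_τ (r τ b : ℝ) :
    HasDerivAt (fun s : ℝ => (r, s, b)) ((0, 1, 0) : ℝ × ℝ × ℝ) τ :=
  (hasDerivAt_const τ r).prodMk ((hasDerivAt_id τ).prodMk (hasDerivAt_const τ b))

theorem hasDerivAt_line_b (r τ b : ℝ) :
    HasDerivAt (fun s : ℝ => (r, τ, s)) ((0, 0, 1) : ℝ × ℝ × ℝ) b :=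
  (hasDerivAt_const b r).prodMk ((hasDerivAt_const b τ).prodMk (hasDerivAt_id b))

/-- Smooth solutions `G(r, τ, b)` of `∂_τ² G + c(τ) ∂_τ G = ∂_r² G` that are even in `r`. -/
structure IsSmoothKernel (c : ℝ → ℂ) (G : ℝ × ℝ × ℝ → ℂ) : Prop where
  contDiffOn : ContDiffOn ℝ ∞ G kernelDomain
  equation : ∀ p ∈ kernelDomain, dirDeriv (0, 1, 0) (dirDeriv (0, 1, 0) G) p
    + c p.2.1 * dirDeriv (0, 1, 0) G p = dirDeriv (1, 0, 0) (dirDeriv (1, 0, 0) G) p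
  even : ∀ r τ b, (r, τ, b) ∈ kernelDomain → G (-r, τ, b) = G (r, τ, b)

theorem IsSmoothKernel.add_smul {c : ℝ → ℂ} {G H : ℝ × ℝ × ℝ → ℂ} (hG : IsSmoothKernel c G)
    (hH : IsSmoothKernel c H) (z : ℂ) : IsSmoothKernel c (fun p => G p + z * H p) where
  contDiffOn := hG.contDiffOn.add (contDiffOn_const.mul hH.contDiffOn)
  equation p hp := by
    have hD := isOpen_kernelDomain
    have h2 (v : ℝ × ℝ × ℝ) : dirDeriv v (dirDeriv v fun p => G p + z * H p) p =
        dirDeriv v (dirDeriv v G) p + z * dirDeriv v (dirDeriv v H) p :=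
      (dirDeriv_congr hD (dirDeriv_add_smul hD hG.contDiffOn hH.contDiffOn z v) v hp).trans
        (dirDeriv_add_smul hD (contDiffOn_dirDeriv hD hG.contDiffOn v)
          (contDiffOn_dirDeriv hD hH.contDiffOn v) z v hp)
    have h1 := dirDeriv_add_smul hD hG.contDiffOn hH.contDiffOn z (0, 1, 0) hp
    rw [h2, h2, h1]
    linear_combination hG.equation p hp + z * hH.equation p hp
  even r τ b h := by simp only [hG.even r τ b h, hH.even r τ b h]

/-- Neither the coefficient nor the operator depends on `b`, so the equation can be differentiated
in `b` and the mixed derivatives commuted. This brings in `K₀`. -/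
theorem IsSmoothKernel.dirDeriv_b {c : ℝ → ℂ} {G : ℝ × ℝ × ℝ → ℂ} (hG : IsSmoothKernel c G) :
    IsSmoothKernel c (dirDeriv (0, 0, 1) G) where
  contDiffOn := contDiffOn_dirDeriv isOpen_kernelDomain hG.contDiffOn _
  equation p hp := by
    have hD := isOpen_kernelDomain
    have hs := hG.contDiffOn
    have hcomm (v : ℝ × ℝ × ℝ) : dirDeriv (0, 0, 1) (dirDeriv v (dirDeriv v G)) p =
        dirDeriv v (dirDeriv v (dirDeriv (0, 0, 1) G)) p :=
      (dirDeriv_comm hD (contDiffOn_dirDeriv hD hs v) _ _ hp).trans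
        (dirDeriv_congr hD (dirDeriv_comm hD hs _ _) v hp)
    obtain ⟨r, τ, b⟩ := p
    have d (v : ℝ × ℝ × ℝ) := hasDerivAt_comp_line hD (contDiffOn_dirDeriv hD
      (contDiffOn_dirDeriv hD hs v) v) (hasDerivAt_line_b r τ b) hp
    have d1 := hasDerivAt_comp_line hD (contDiffOn_dirDeriv hD hs (0, 1, 0))
      (hasDerivAt_line_b r τ b) hp
    have hev : (fun s => dirDeriv (0, 1, 0) (dirDeriv (0, 1, 0) G) (r, τ, s) +
        c τ * dirDeriv (0, 1, 0) G (r, τ, s)) =ᶠ[𝓝 b]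
        fun s => dirDeriv (1, 0, 0) (dirDeriv (1, 0, 0) G) (r, τ, s) := by
      have hcont : ContinuousAt (fun s : ℝ => (r, τ, s)) b := by fun_prop
      filter_upwards [hcont.eventually (hD.mem_nhds hp)] with s h
      exact hG.equation _ h
    have := ((d (0, 1, 0)).add (d1.const_mul (c τ))).unique ((d (1, 0, 0)).congr_of_eventuallyEq hev)
    rw [hcomm, hcomm, dirDeriv_comm hD hs _ _ hp] at this
    exact this
  even r τ b h := by
    have hD := isOpen_kernelDomain
    have h' : (-r, τ, b) ∈ kernelDomain := by simpa [kernelDomain] using h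
    have d1 := hasDerivAt_comp_line hD hG.contDiffOn (hasDerivAt_line_b r τ b) h
    have d2 := hasDerivAt_comp_line hD hG.contDiffOn (hasDerivAt_line_b (-r) τ b) h'
    refine d2.unique (d1.congr_of_eventuallyEq ?_)
    have hcont : ContinuousAt (fun s : ℝ => (r, τ, s)) b := by fun_prop
    filter_upwards [hcont.eventually (hD.mem_nhds h)] with s hs
    exact hG.even _ _ _ hs

theorem isSmoothKernel_kernelE (m : ℂ) :
    IsSmoothKernel (fun τ => 2 * Complex.I * m / ((τ + 1 : ℝ) : ℂ))
      (fun p => kernelE m p.1 p.2.1 p.2.2) where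
  contDiffOn := contDiffOn_kernelE m
  equation p hp := by
    obtain ⟨et, er, h⟩ := kernelE_hasDerivAt m
    have hD := isOpen_kernelDomain
    have hs := contDiffOn_kernelE m
    have ht : EqOn (dirDeriv (0, 1, 0) (fun p : ℝ × ℝ × ℝ => kernelE m p.1 p.2.1 p.2.2))
        (fun p => et p.1 p.2.1 p.2.2) kernelDomain := by
      rintro ⟨r, τ, b⟩ hp
      obtain ⟨_, _, h1, -⟩ := h r τ b hp
      exact (hasDerivAt_comp_line hD hs (hasDerivAt_line_τ r τ b) hp).unique h1
    have hr : EqOn (dirDeriv (1, 0, 0) (fun p : ℝ × ℝ × ℝ => kernelE m p.1 p.2.1 p.2.2))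
        (fun p => er p.1 p.2.1 p.2.2) kernelDomain := by
      rintro ⟨r, τ, b⟩ hp
      obtain ⟨_, _, -, -, h1, -⟩ := h r τ b hp
      exact (hasDerivAt_comp_line hD hs (hasDerivAt_line_r r τ b) hp).unique h1
    obtain ⟨r, τ, b⟩ := p
    obtain ⟨ett, err, -, h2, -, h4, h5⟩ := h r τ b hp
    have e1 := (hasDerivAt_comp_line hD ((contDiffOn_dirDeriv hD hs _).congr
      fun x hx => (ht hx).symm) (hasDerivAt_line_τ r τ b) hp).unique h2
    have e2 := (hasDerivAt_comp_line hD ((contDiffOn_dirDeriv hD hs _).congr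
      fun x hx => (hr hx).symm) (hasDerivAt_line_r r τ b) hp).unique h4
    rw [dirDeriv_congr hD ht _ hp, dirDeriv_congr hD hr _ hp, ht hp, e1, e2]
    linear_combination h5
  even r τ b _ := by simp [kernelE]

/-! ### Restriction to `b = 0`. -/

/-- The set of `(r, τ)` with `(r, τ, 0) ∈ kernelDomain`. -/
def sliceDomain : Set (ℝ × ℝ) := {p | -1 < p.2 ∧ p.1 ^ 2 < (p.2 + 1) ^ 2 + 1}

theorem mem_sliceDomain_iff {r τ : ℝ} : (r, τ) ∈ sliceDomain ↔ (r, τ, (0 : ℝ)) ∈ kernelDomain := by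
  simp [sliceDomain, kernelDomain]

theorem isOpen_sliceDomain : IsOpen sliceDomain :=
  (isOpen_lt (f := fun _ : ℝ × ℝ => (-1 : ℝ)) (g := fun p => p.2) (by fun_prop) (by fun_prop)).inter
    (isOpen_lt (f := fun p : ℝ × ℝ => p.1 ^ 2) (g := fun p => (p.2 + 1) ^ 2 + 1)
      (by fun_prop) (by fun_prop))

/-- Times in `(-1, 0)` are included, with `r` between `τ` and `0`, so that Volterra integrals have
two-sided derivatives at `τ = 0`. -/
theorem mem_sliceDomain_of_mem_uIcc {r τ : ℝ} (hτ : -1 < τ) (hr : r ∈ uIcc 0 τ) :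
    (r, τ) ∈ sliceDomain := by
  refine ⟨hτ, ?_⟩
  simp only
  rcases le_total 0 τ with h | h
  · rw [uIcc_of_le h] at hr
    nlinarith [hr.1, hr.2]
  · rw [uIcc_of_ge h] at hr
    nlinarith [hr.1, hr.2]

/-- A kernel `K(r, τ)` with its partial derivatives, solving `K_ττ + c(τ) K_τ = K_rr`, with
`K_r = 0` at `r = 0`. -/
structure IsEPDKernel (c : ℝ → ℂ) (K Kt Ktt Kr Krr : ℝ → ℝ → ℂ) : Prop where
  cont : ContinuousOn (fun p : ℝ × ℝ => K p.1 p.2) sliceDomain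
  cont_t : ContinuousOn (fun p : ℝ × ℝ => Kt p.1 p.2) sliceDomain
  cont_tt : ContinuousOn (fun p : ℝ × ℝ => Ktt p.1 p.2) sliceDomain
  cont_rr : ContinuousOn (fun p : ℝ × ℝ => Krr p.1 p.2) sliceDomain
  deriv_t : ∀ r τ, (r, τ) ∈ sliceDomain → HasDerivAt (fun t => K r t) (Kt r τ) τ
  deriv_tt : ∀ r τ, (r, τ) ∈ sliceDomain → HasDerivAt (fun t => Kt r t) (Ktt r τ) τ
  deriv_r : ∀ r τ, (r, τ) ∈ sliceDomain → HasDerivAt (fun s => K s τ) (Kr r τ) r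
  deriv_rr : ∀ r τ, (r, τ) ∈ sliceDomain → HasDerivAt (fun s => Kr s τ) (Krr r τ) r
  deriv_diag : ∀ τ, -1 < τ → HasDerivAt (fun t => K t t) (Kr τ τ + Kt τ τ) τ
  deriv_r_zero : ∀ τ, -1 < τ → Kr 0 τ = 0
  equation : ∀ r τ, (r, τ) ∈ sliceDomain → Ktt r τ + c τ * Kt r τ = Krr r τ

theorem IsSmoothKernel.isEPDKernel {c : ℝ → ℂ} {G : ℝ × ℝ × ℝ → ℂ} (hG : IsSmoothKernel c G) :
    ∃ Kt Ktt Kr Krr, IsEPDKernel c (fun r τ => G (r, τ, 0)) Kt Ktt Kr Krr := by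
  have hD := isOpen_kernelDomain
  have hs := hG.contDiffOn
  have hcont {H : ℝ × ℝ × ℝ → ℂ} (hH : ContDiffOn ℝ ∞ H kernelDomain) :
      ContinuousOn (fun p : ℝ × ℝ => H (p.1, p.2, 0)) sliceDomain :=
    hH.continuousOn.comp (by fun_prop) fun p hp => mem_sliceDomain_iff.1 hp
  have hsv := contDiffOn_dirDeriv hD hs
  have diag (τ : ℝ) (hτ : -1 < τ) : (τ, τ) ∈ sliceDomain :=
    mem_sliceDomain_of_mem_uIcc hτ right_mem_uIcc
  refine ⟨fun r τ => dirDeriv (0, 1, 0) G (r, τ, 0),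
    fun r τ => dirDeriv (0, 1, 0) (dirDeriv (0, 1, 0) G) (r, τ, 0),
    fun r τ => dirDeriv (1, 0, 0) G (r, τ, 0),
    fun r τ => dirDeriv (1, 0, 0) (dirDeriv (1, 0, 0) G) (r, τ, 0),
    hcont hs, hcont (hsv _), hcont (contDiffOn_dirDeriv hD (hsv _) _),
    hcont (contDiffOn_dirDeriv hD (hsv _) _), ?_, ?_, ?_, ?_, ?_, ?_, ?_⟩
  · exact fun r τ h => hasDerivAt_comp_line hD hs (hasDerivAt_line_τ r τ 0) (mem_sliceDomain_iff.1 h)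
  · exact fun r τ h =>
      hasDerivAt_comp_line hD (hsv _) (hasDerivAt_line_τ r τ 0) (mem_sliceDomain_iff.1 h)
  · exact fun r τ h => hasDerivAt_comp_line hD hs (hasDerivAt_line_r r τ 0) (mem_sliceDomain_iff.1 h)
  · exact fun r τ h =>
      hasDerivAt_comp_line hD (hsv _) (hasDerivAt_line_r r τ 0) (mem_sliceDomain_iff.1 h)
  · intro τ hτ
    have hl : HasDerivAt (fun s : ℝ => (s, s, (0 : ℝ))) ((1, 1, 0) : ℝ × ℝ × ℝ) τ :=
      (hasDerivAt_id τ).prodMk ((hasDerivAt_id τ).prodMk (hasDerivAt_const τ 0))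
    refine (hasDerivAt_comp_line hD hs hl (mem_sliceDomain_iff.1 (diag τ hτ))).congr_deriv ?_
    simp only [dirDeriv]
    rw [← map_add]
    simp
  · intro τ hτ
    have h0 : ((0 : ℝ), τ) ∈ sliceDomain := mem_sliceDomain_of_mem_uIcc hτ left_mem_uIcc
    have h0' := mem_sliceDomain_iff.1 h0
    have d := hasDerivAt_comp_line hD hs (hasDerivAt_line_r 0 τ 0) h0'
    have d' : HasDerivAt (fun s : ℝ => G (-s, τ, 0)) (-dirDeriv (1, 0, 0) G (0, τ, 0)) 0 := by
      have := d.scomp_of_eq 0 (hasDerivAt_neg 0) (by simp)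
      simpa [Function.comp_def] using this
    have hev : (fun s : ℝ => G (-s, τ, 0)) =ᶠ[𝓝 0] fun s => G (s, τ, 0) := by
      have hc : ContinuousAt (fun s : ℝ => (s, τ, (0 : ℝ))) 0 := by fun_prop
      filter_upwards [hc.eventually (hD.mem_nhds h0')] with s h
      exact hG.even _ _ _ h
    have := d'.unique (d.congr_of_eventuallyEq hev)
    exact self_eq_neg.1 this.symm
  · exact fun r τ h => hG.equation _ (mem_sliceDomain_iff.1 h)

/-! ### Volterra integrals against an EPD kernel. -/

theorem continuousOn_slice {K : ℝ → ℝ → ℂ}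
    (hK : ContinuousOn (fun p : ℝ × ℝ => K p.1 p.2) sliceDomain) {v : ℝ → ℂ} (hv : Continuous v)
    {τ : ℝ} {s : Set ℝ} (hs : ∀ r ∈ s, (r, τ) ∈ sliceDomain) :
    ContinuousOn (fun r => K r τ * v r) s :=
  (hK.comp (f := fun r : ℝ => (r, τ)) (by fun_prop) hs).mul hv.continuousOn

theorem intervalIntegrable_slice {K : ℝ → ℝ → ℂ}
    (hK : ContinuousOn (fun p : ℝ × ℝ => K p.1 p.2) sliceDomain) {v : ℝ → ℂ} (hv : Continuous v)
    {τ : ℝ} (hτ : -1 < τ) : IntervalIntegrable (fun r => K r τ * v r) volume 0 τ :=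
  (continuousOn_slice hK hv fun _ hr => mem_sliceDomain_of_mem_uIcc hτ hr).intervalIntegrable

/-- If `f` is continuous at `(τ, τ)`, then `t ↦ ∫ r in τ..t, f r t` has derivative `f τ τ` at `τ`. -/
theorem hasDerivAt_integral_diag {f : ℝ → ℝ → ℂ} {τ : ℝ}
    (hf : ContinuousAt (fun p : ℝ × ℝ => f p.1 p.2) (τ, τ))
    (hint : ∀ᶠ t in 𝓝 τ, IntervalIntegrable (fun r => f r t) volume τ t) :
    HasDerivAt (fun t => ∫ r in τ..t, f r t) (f τ τ) τ := by
  rw [hasDerivAt_iff_isLittleO, Asymptotics.isLittleO_iff]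
  intro ε hε
  obtain ⟨δ, hδ, h⟩ := Metric.continuousAt_iff.1 hf ε hε
  filter_upwards [hint, Metric.ball_mem_nhds τ hδ] with t hi ht
  have hc : (t - τ) • f τ τ = ∫ _ in τ..t, f τ τ := by simp
  rw [intervalIntegral.integral_same, sub_zero, hc,
    ← intervalIntegral.integral_sub hi intervalIntegrable_const, Real.norm_eq_abs]
  refine intervalIntegral.norm_integral_le_of_norm_le_const fun r hr => ?_
  have hr' : dist r τ ≤ dist t τ := by
    have := abs_sub_left_of_mem_uIcc (uIoc_subset_uIcc hr)
    simpa [Real.dist_eq] using this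
  rw [← dist_eq_norm]
  refine (h (x := (r, t)) ?_).le
  rw [Prod.dist_eq]
  exact max_lt (hr'.trans_lt ht) ht

/-- Leibniz' rule for Volterra integrals. -/
theorem hasDerivAt_volterra {K Kt : ℝ → ℝ → ℂ}
    (hK : ContinuousOn (fun p : ℝ × ℝ => K p.1 p.2) sliceDomain)
    (hKt : ContinuousOn (fun p : ℝ × ℝ => Kt p.1 p.2) sliceDomain)
    (hd : ∀ r τ, (r, τ) ∈ sliceDomain → HasDerivAt (fun t => K r t) (Kt r τ) τ)
    {v : ℝ → ℂ} (hv : Continuous v) {τ : ℝ} (hτ : -1 < τ) :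
    HasDerivAt (fun t => ∫ r in (0 : ℝ)..t, K r t * v r)
      (K τ τ * v τ + ∫ r in (0 : ℝ)..τ, Kt r τ * v r) τ := by
  have hsub : uIcc 0 τ ×ˢ {τ} ⊆ sliceDomain := by
    rintro ⟨r, t⟩ ⟨hr, ht⟩
    obtain rfl : t = τ := ht
    exact mem_sliceDomain_of_mem_uIcc hτ hr
  -- A compact box around the segment `[0, τ] × {τ}` inside the domain gives the uniform bound on
  -- `Kt` needed to differentiate under the integral; `∫₀^t` is then split at the fixed point `τ`.
  obtain ⟨U, V, hU, hV, hsU, hsV, hUV⟩ := generalized_tube_lemma (isCompact_uIcc (a := 0) (b := τ))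
    (isCompact_singleton (x := τ)) isOpen_sliceDomain hsub
  obtain ⟨δ, hδ, hδV⟩ := Metric.nhds_basis_closedBall.mem_iff.1 (hV.mem_nhds (hsV rfl))
  have hbox : uIcc 0 τ ×ˢ Metric.closedBall τ δ ⊆ sliceDomain :=
    (prod_mono hsU hδV).trans hUV
  have hmem {r t : ℝ} (hr : r ∈ uIcc 0 τ) (ht : t ∈ Metric.ball τ δ) : (r, t) ∈ sliceDomain :=
    hbox ⟨hr, Metric.ball_subset_closedBall ht⟩
  have hnear : ∀ᶠ t in 𝓝 τ, t ∈ Metric.ball τ δ := Metric.ball_mem_nhds τ hδ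
  have hnear' : ∀ᶠ t in 𝓝 τ, -1 < t := lt_mem_nhds hτ
  have hfix {L : ℝ → ℝ → ℂ} (hL : ContinuousOn (fun p : ℝ × ℝ => L p.1 p.2) sliceDomain) {t : ℝ}
      (ht : t ∈ Metric.ball τ δ) : ContinuousOn (fun r => L r t * v r) (uIcc 0 τ) :=
    continuousOn_slice hL hv fun r hr => hmem hr ht
  obtain ⟨M, hM⟩ := (isCompact_uIcc.prod (isCompact_closedBall τ δ)).exists_bound_of_continuousOn
    ((hKt.mono hbox).mul (hv.comp continuous_fst).continuousOn)
  have hA : HasDerivAt (fun t => ∫ r in (0 : ℝ)..τ, K r t * v r)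
      (∫ r in (0 : ℝ)..τ, Kt r τ * v r) τ := by
    have hself : τ ∈ Metric.ball τ δ := Metric.mem_ball_self hδ
    refine (intervalIntegral.hasDerivAt_integral_of_dominated_loc_of_deriv_le
      (F := fun t r => K r t * v r) (F' := fun t r => Kt r t * v r)
      (bound := fun _ => M) (Metric.ball_mem_nhds τ hδ) ?_ (hfix hK hself).intervalIntegrable
      ?_ ?_ intervalIntegrable_const ?_).2
    · filter_upwards [hnear] with t ht
      exact ((hfix hK ht).mono uIoc_subset_uIcc).aestronglyMeasurable measurableSet_uIoc
    · exact ((hfix hKt hself).mono uIoc_subset_uIcc).aestronglyMeasurable measurableSet_uIoc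
    · exact .of_forall fun r hr t ht =>
        hM (r, t) ⟨uIoc_subset_uIcc hr, Metric.ball_subset_closedBall ht⟩
    · exact .of_forall fun r hr t ht => (hd r t (hmem (uIoc_subset_uIcc hr) ht)).mul_const _
  have hdiag : (τ, τ) ∈ sliceDomain := mem_sliceDomain_of_mem_uIcc hτ right_mem_uIcc
  have hB : HasDerivAt (fun t => ∫ r in τ..t, K r t * v r) (K τ τ * v τ) τ := by
    refine hasDerivAt_integral_diag (f := fun r t => K r t * v r)
      ((hK.continuousAt (isOpen_sliceDomain.mem_nhds hdiag)).mul
        (hv.comp continuous_fst).continuousAt) ?_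
    filter_upwards [hnear, hnear'] with t ht ht'
    exact (hfix hK ht).intervalIntegrable.symm.trans (intervalIntegrable_slice hK hv ht')
  refine ((hB.add hA).congr_of_eventuallyEq ?_)
  filter_upwards [hnear, hnear'] with t ht ht'
  have := intervalIntegral.integral_add_adjacent_intervals (hfix hK ht).intervalIntegrable
    ((hfix hK ht).intervalIntegrable.symm.trans (intervalIntegrable_slice hK hv ht'))
  rw [← this, add_comm]
  rfl

/-- Volterra integrals against an EPD kernel transform solutions of the wave equation into
solutions of the EPD equation, up to a term on the diagonal. -/
theorem IsEPDKernel.hasDerivAt_deriv_volterra {c : ℝ → ℂ} {K Kt Ktt Kr Krr : ℝ → ℝ → ℂ}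
    (hK : IsEPDKernel c K Kt Ktt Kr Krr) {V₀ V₁ V₂ : ℝ → ℂ}
    (h0 : ∀ r, HasDerivAt V₀ (V₁ r) r) (h1 : ∀ r, HasDerivAt V₁ (V₂ r) r) (h2 : Continuous V₂)
    (hV : V₁ 0 = 0) {τ : ℝ} (hτ : -1 < τ) :
    HasDerivAt (fun t => K t t * V₀ t + ∫ r in (0 : ℝ)..t, Kt r t * V₀ r)
      ((∫ r in (0 : ℝ)..τ, K r τ * V₂ r)
        - c τ * (K τ τ * V₀ τ + ∫ r in (0 : ℝ)..τ, Kt r τ * V₀ r)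
        + (2 * (Kr τ τ + Kt τ τ) + c τ * K τ τ) * V₀ τ) τ := by
  have hc0 : Continuous V₀ := continuous_iff_continuousAt.2 fun r => (h0 r).continuousAt
  have hc1 : Continuous V₁ := continuous_iff_continuousAt.2 fun r => (h1 r).continuousAt
  have hmem {r : ℝ} (hr : r ∈ uIcc 0 τ) := mem_sliceDomain_of_mem_uIcc hτ hr
  have hd := ((hK.deriv_diag τ hτ).mul (h0 τ)).add
    (hasDerivAt_volterra hK.cont_t hK.cont_tt hK.deriv_tt hc0 hτ)
  refine hd.congr_deriv ?_
  have hKr : ContinuousOn (fun r => Kr r τ) (uIcc 0 τ) := fun r hr =>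
    (hK.deriv_rr r τ (hmem hr)).continuousAt.continuousWithinAt
  have hKrr : ContinuousOn (fun r => Krr r τ) (uIcc 0 τ) :=
    hK.cont_rr.comp (f := fun r : ℝ => (r, τ)) (by fun_prop) fun _ hr => hmem hr
  -- Two integrations by parts move both derivatives from `V₀` to `K`; the boundary terms at `0`
  -- contain `V₁ 0` and `Kr 0 τ`.
  have p1 := intervalIntegral.integral_mul_deriv_eq_deriv_mul
    (fun r hr => hK.deriv_r r τ (hmem hr)) (fun r _ => h1 r) hKr.intervalIntegrable
    (h2.intervalIntegrable 0 τ)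
  have p2 := intervalIntegral.integral_mul_deriv_eq_deriv_mul
    (fun r hr => hK.deriv_rr r τ (hmem hr)) (fun r _ => h0 r) hKrr.intervalIntegrable
    (hc1.intervalIntegrable 0 τ)
  have p3 : ∫ r in (0 : ℝ)..τ, Krr r τ * V₀ r =
      (∫ r in (0 : ℝ)..τ, Ktt r τ * V₀ r) + c τ * ∫ r in (0 : ℝ)..τ, Kt r τ * V₀ r := by
    rw [← intervalIntegral.integral_const_mul, ← intervalIntegral.integral_add
      (intervalIntegrable_slice hK.cont_tt hc0 hτ)
      ((intervalIntegrable_slice hK.cont_t hc0 hτ).const_mul _)]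
    refine intervalIntegral.integral_congr fun r hr => ?_
    rw [← hK.equation r τ (hmem hr)]
    ring
  rw [hV, hK.deriv_r_zero τ hτ] at *
  rw [p1, p2, p3]
  ring

/-! ### Weak integrals in the dual of a barrelled space. -/

section WeakIntegral

variable {T : Type*} [AddCommGroup T] [Module ℂ T] [TopologicalSpace T]

/-- Banach-Steinhaus: the seminorms `f ↦ ‖u r f‖`, `r ∈ [0, τ]`, are pointwise bounded by weak
continuity, so on a barrelled space their supremum is continuous. It dominates the integral, which
is therefore a continuous functional. -/
theorem exists_isWeakIntegral [IsTopologicalAddGroup T] [BarrelledSpace ℂ T] {k : ℝ → ℂ}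
    {u : ℝ → T →L[ℂ] ℂ} {τ : ℝ} (hτ : 0 ≤ τ) (hk : ContinuousOn k (uIcc 0 τ))
    (hu : ∀ f : T, ContinuousOn (fun r => u r f) (Ici 0)) : ∃ w, IsWeakIntegral k u τ w := by
  have hsub : uIcc 0 τ ⊆ Ici 0 := by
    rw [uIcc_of_le hτ]
    exact Icc_subset_Ici_self
  have hi (f : T) : IntervalIntegrable (fun r => k r * u r f) volume 0 τ :=
    (hk.mul ((hu f).mono hsub)).intervalIntegrable
  let L : T →ₗ[ℂ] ℂ :=
    { toFun := fun f => ∫ r in (0 : ℝ)..τ, k r * u r f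
      map_add' := fun f g => by
        rw [← intervalIntegral.integral_add (hi f) (hi g)]
        simp only [map_add, mul_add]
      map_smul' := fun z f => by
        rw [RingHom.id_apply, smul_eq_mul, ← intervalIntegral.integral_const_mul]
        simp only [map_smul, smul_eq_mul]
        congr 1
        funext r
        ring }
  let p : uIcc 0 τ → Seminorm ℂ T := fun r => (normSeminorm ℂ ℂ).comp (u r : T →ₗ[ℂ] ℂ)
  have hpb (f : T) : BddAbove (range fun r => p r f) := by
    obtain ⟨C, hC⟩ := isCompact_uIcc.exists_bound_of_continuousOn ((hu f).mono hsub)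
    refine ⟨C, ?_⟩
    rintro _ ⟨r, rfl⟩
    exact hC r r.2
  have hpc := Seminorm.continuous_iSup p (fun r => (u r).continuous.norm)
    (Seminorm.bddAbove_range_iff.2 hpb)
  obtain ⟨C, hC⟩ := isCompact_uIcc.exists_bound_of_continuousOn hk
  have hle (f : T) : ‖L f‖ ≤ C * (⨆ r, p r f) * |τ - 0| := by
    refine intervalIntegral.norm_integral_le_of_norm_le_const fun r hr => ?_
    have hr' := uIoc_subset_uIcc hr
    rw [norm_mul]
    exact mul_le_mul (hC r hr') (le_ciSup (hpb f) ⟨r, hr'⟩) (norm_nonneg _)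
      ((norm_nonneg _).trans (hC r hr'))
  have hL : Continuous L := by
    refine continuous_of_continuousAt_zero L ?_
    rw [ContinuousAt, map_zero]
    refine squeeze_zero_norm hle ?_
    have h0 : Tendsto (fun f => ⨆ r, p r f) (𝓝 0) (𝓝 0) := by
      have := hpc.tendsto 0
      simp only [iSup_apply, map_zero, Real.iSup_const_zero] at this
      refine this.congr fun f => ?_
      simp
    simpa using (h0.const_mul C).mul_const |τ - 0|
  exact ⟨⟨L, hL⟩, fun f => ⟨hi f, rfl⟩⟩

theorem IsWeakIntegral.congr {k k' : ℝ → ℂ} {u : ℝ → T →L[ℂ] ℂ} {τ : ℝ} {w : T →L[ℂ] ℂ}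
    (h : IsWeakIntegral k u τ w) (hk : EqOn k k' (uIcc 0 τ)) : IsWeakIntegral k' u τ w := by
  have he (f : T) : EqOn (fun r => k r * u r f) (fun r => k' r * u r f) (uIcc 0 τ) :=
    fun r hr => by simp only [hk hr]
  exact fun f => ⟨(intervalIntegrable_congr ((he f).mono uIoc_subset_uIcc)).1 (h f).1,
    (h f).2.trans (intervalIntegral.integral_congr (he f))⟩

theorem IsWeakIntegral.eq_integral {k : ℝ → ℂ} {u : ℝ → T →L[ℂ] ℂ} {τ : ℝ} {w : T →L[ℂ] ℂ}
    (h : IsWeakIntegral k u τ w) (hτ : 0 ≤ τ) {f : T} {v : ℝ → ℂ}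
    (hv : ∀ r, 0 ≤ r → v r = u r f) : w f = ∫ r in (0 : ℝ)..τ, k r * v r := by
  rw [(h f).2]
  refine intervalIntegral.integral_congr fun r hr => ?_
  rw [uIcc_of_le hτ] at hr
  simp only [hv r hr.1]

/-- The weak Volterra integrals of a weakly continuous family against an EPD kernel. -/
theorem IsEPDKernel.exists_family [IsTopologicalAddGroup T] [BarrelledSpace ℂ T] {c : ℝ → ℂ}
    {K Kt Ktt Kr Krr : ℝ → ℝ → ℂ} (hK : IsEPDKernel c K Kt Ktt Kr Krr) {u : ℝ → T →L[ℂ] ℂ}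
    (hu : ∀ f : T, ContinuousOn (fun r => u r f) (Ici 0)) :
    ∃ I : ℝ → T →L[ℂ] ℂ, (∀ τ, 0 ≤ τ → IsWeakIntegral (fun r => K r τ) u τ (I τ)) ∧
      ∀ f : T, ContinuousOn (fun τ => I τ f) (Ici 0) := by
  have h (τ : ℝ) : ∃ w, 0 ≤ τ → IsWeakIntegral (fun r => K r τ) u τ w := by
    by_cases hτ : 0 ≤ τ
    · have hk : ContinuousOn (fun r => K r τ) (uIcc 0 τ) :=
        hK.cont.comp (f := fun r : ℝ => (r, τ)) (by fun_prop)
          fun _ hr => mem_sliceDomain_of_mem_uIcc (by linarith) hr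
      obtain ⟨w, hw⟩ := exists_isWeakIntegral hτ hk hu
      exact ⟨w, fun _ => hw⟩
    · exact ⟨0, fun h => absurd h hτ⟩
  choose I hI using h
  refine ⟨I, hI, fun f τ hτ => ?_⟩
  -- Reflecting in time makes the integrand continuous on all of `ℝ`; continuity in `τ` then follows
  -- from differentiability of the Volterra integral.
  have hv : Continuous fun r : ℝ => u |r| f :=
    (hu f).comp_continuous continuous_abs fun r => abs_nonneg r
  have hτ' : (-1 : ℝ) < τ := by linarith [mem_Ici.1 hτ]
  have hd := hasDerivAt_volterra hK.cont hK.cont_t hK.deriv_t hv hτ'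
  refine hd.continuousAt.continuousWithinAt.congr (fun t ht => ?_) ?_
  · exact (hI t ht).eq_integral ht fun r hr => by rw [abs_of_nonneg hr]
  · exact (hI τ hτ).eq_integral hτ fun r hr => by rw [abs_of_nonneg hr]

end WeakIntegral

/-! ### Even extension in time and reduction to scalar functions. -/

/-- The even extension of a `C²` function on `[0, ∞)` with vanishing derivative at `0`. -/
theorem exists_even_extension {v v₁ v₂ : ℝ → ℂ}
    (h0 : ∀ r, 0 ≤ r → HasDerivWithinAt v (v₁ r) (Ici 0) r)
    (h1 : ∀ r, 0 ≤ r → HasDerivWithinAt v₁ (v₂ r) (Ici 0) r)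
    (h2 : ContinuousOn v₂ (Ici 0)) (hv : v₁ 0 = 0) :
    ∃ V₀ V₁ : ℝ → ℂ, (∀ r, HasDerivAt V₀ (V₁ r) r) ∧ (∀ r, HasDerivAt V₁ (v₂ |r|) r) ∧
      V₁ 0 = 0 ∧ ∀ r, 0 ≤ r → V₀ r = v r := by
  have hc2 : Continuous fun r : ℝ => v₂ |r| :=
    h2.comp_continuous continuous_abs fun r => abs_nonneg r
  -- Integrating the reflected second derivative twice avoids gluing two branches at `0`.
  set V₁ : ℝ → ℂ := fun r => ∫ s in (0 : ℝ)..r, v₂ |s| with hV₁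
  have d1 (r : ℝ) : HasDerivAt V₁ (v₂ |r|) r := hc2.integral_hasStrictDerivAt 0 r |>.hasDerivAt
  have hc1 : Continuous V₁ := continuous_iff_continuousAt.2 fun r => (d1 r).continuousAt
  have key {f f' g : ℝ → ℂ} (hf : ∀ r, 0 ≤ r → HasDerivWithinAt f (f' r) (Ici 0) r)
      (hg : Continuous g) (hfg : ∀ r, 0 ≤ r → f' r = g r) (r : ℝ) (hr : 0 ≤ r) :
      ∫ s in (0 : ℝ)..r, g s = f r - f 0 := by
    refine intervalIntegral.integral_eq_sub_of_hasDerivAt_of_le hr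
      (fun s hs => ((hf s hs.1).continuousWithinAt).mono Icc_subset_Ici_self) (fun s hs => ?_)
      (hg.intervalIntegrable _ _)
    rw [← hfg s hs.1.le]
    exact (hf s hs.1.le).hasDerivAt (Ici_mem_nhds hs.1)
  have e1 (r : ℝ) (hr : 0 ≤ r) : v₁ r = V₁ r := by
    simp only [hV₁, key h1 hc2 (fun s hs => by rw [abs_of_nonneg hs]) r hr, hv, sub_zero]
  refine ⟨fun r => v 0 + ∫ s in (0 : ℝ)..r, V₁ s, V₁, fun r => ?_, d1, by simp [hV₁], fun r hr => ?_⟩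
  · exact (hc1.integral_hasStrictDerivAt 0 r).hasDerivAt.const_add _
  · simp only [key h0 hc1 e1 r hr]
    ring

section Cauchy

variable {n : ℕ} {Ω : Opens (Space n)} {T : Type*} [AddCommGroup T] [Module ℂ T]
  [TopologicalSpace T] {S : TestSpace Ω T} {At : 𝓓(Ω, ℂ) →L[ℂ] T}

/-- It suffices to find, for each `φ`, a scalar function with two-sided derivatives satisfying the
equation. Continuity of the second derivative is automatic, since the equation expresses it through
`u τ (At φ)`, `c` and `w₁`. -/
theorem solvesCauchy_of_hasDerivAt {c : ℝ → ℂ} {g₀ g₁ : Distr Ω} {u : ℝ → T →L[ℂ] ℂ}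
    (hu : ∀ f : T, ContinuousOn (fun τ => u τ f) (Ici 0)) (hc : ContinuousOn c (Ici 0))
    (h : ∀ φ : 𝓓(Ω, ℂ), ∃ w w₁ : ℝ → ℂ, (∀ τ, 0 ≤ τ → u τ (S.incl φ) = w τ) ∧
      (∀ τ, 0 ≤ τ → HasDerivAt w (w₁ τ) τ) ∧
      (∀ τ, 0 ≤ τ → HasDerivAt w₁ (u τ (At φ) - c τ * w₁ τ) τ) ∧ w 0 = g₀ φ ∧ w₁ 0 = g₁ φ) :
    SolvesCauchy S At c g₀ g₁ u := by
  have hU := uniqueDiffOn_Ici (0 : ℝ)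
  have h' (φ : 𝓓(Ω, ℂ)) : ∃ w₁ : ℝ → ℂ,
      DifferentiableOn ℝ (fun τ => S.toDistr (u τ) φ) (Ici 0) ∧
      EqOn (derivWithin (fun τ => S.toDistr (u τ) φ) (Ici 0)) w₁ (Ici 0) ∧
      (∀ τ, 0 ≤ τ → HasDerivAt w₁ (u τ (At φ) - c τ * w₁ τ) τ) ∧
      S.toDistr (u 0) φ = g₀ φ ∧ w₁ 0 = g₁ φ := by
    obtain ⟨w, w₁, hw, hd, hd1, i0, i1⟩ := h φ
    have hd' (τ : ℝ) (hτ : 0 ≤ τ) :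
        HasDerivWithinAt (fun τ => S.toDistr (u τ) φ) (w₁ τ) (Ici 0) τ :=
      (hd τ hτ).hasDerivWithinAt.congr hw (hw τ hτ)
    exact ⟨w₁, fun τ hτ => (hd' τ hτ).differentiableWithinAt,
      fun τ hτ => (hd' τ hτ).derivWithin (hU τ hτ), hd1, (hw 0 le_rfl).trans i0, i1⟩
  refine ⟨hu, fun φ => ?_, fun φ τ hτ => ?_, ?_, fun φ => ?_⟩
  · obtain ⟨w₁, hd, he, hd1, -⟩ := h' φ
    have hw₁ : ContinuousOn w₁ (Ici 0) := fun τ hτ => (hd1 τ hτ).continuousAt.continuousWithinAt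
    have hw₁' : ContDiffOn ℝ 1 w₁ (Ici 0) := by
      rw [show (1 : ℕ∞ω) = 0 + 1 by simp, contDiffOn_succ_iff_derivWithin hU]
      refine ⟨fun τ hτ => (hd1 τ hτ).differentiableAt.differentiableWithinAt, by simp, ?_⟩
      rw [contDiffOn_zero]
      exact ((hu (At φ)).sub (hc.mul hw₁)).congr fun τ hτ =>
        (hd1 τ hτ).hasDerivWithinAt.derivWithin (hU τ hτ)
    rw [show (2 : ℕ∞ω) = 1 + 1 by norm_num, contDiffOn_succ_iff_derivWithin hU]
    exact ⟨hd, by simp, hw₁'.congr he⟩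
  · obtain ⟨w₁, hd, he, hd1, -⟩ := h' φ
    have e2 : iteratedDerivWithin 2 (fun s => S.toDistr (u s) φ) (Ici 0) τ =
        u τ (At φ) - c τ * w₁ τ := by
      rw [iteratedDerivWithin_succ, iteratedDerivWithin_one]
      rw [derivWithin_congr he (he hτ)]
      exact (hd1 τ hτ).hasDerivWithinAt.derivWithin (hU τ hτ)
    rw [e2, he hτ]
    simp only [applyOp, ContinuousLinearMap.comp_apply]
    ring
  · ext φ
    obtain ⟨w₁, -, -, -, i0, -⟩ := h' φ
    exact i0
  · obtain ⟨w₁, -, he, -, -, i1⟩ := h' φ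
    exact (he self_mem_Ici).trans i1

/-- The even extension in time of a solution of the wave equation with zero initial velocity. -/
theorem SolvesCauchy.exists_even_extension {g₀ : Distr Ω} {u : ℝ → T →L[ℂ] ℂ}
    (hu : SolvesCauchy S At (fun _ => 0) g₀ 0 u) (φ : 𝓓(Ω, ℂ)) :
    ∃ V₀ V₁ : ℝ → ℂ, (∀ r, HasDerivAt V₀ (V₁ r) r) ∧ (∀ r, HasDerivAt V₁ (u |r| (At φ)) r) ∧
      V₁ 0 = 0 ∧ ∀ r, 0 ≤ r → V₀ r = u r (S.incl φ) := by
  have hU := uniqueDiffOn_Ici (0 : ℝ)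
  have hcd := hu.contDiffOn φ
  refine EPD.exists_even_extension (v := fun r => S.toDistr (u r) φ)
    (v₁ := derivWithin (fun s => S.toDistr (u s) φ) (Ici 0)) (v₂ := fun r => u r (At φ))
    (fun r hr => ((hcd.differentiableOn (by simp)) r hr).hasDerivWithinAt) (fun r hr => ?_)
    (hu.continuousOn (At φ)) (hu.initial_deriv φ)
  have hd : DifferentiableWithinAt ℝ (derivWithin (fun s => S.toDistr (u s) φ) (Ici 0)) (Ici 0) r := by
    rw [show (2 : ℕ∞ω) = 1 + 1 by norm_num, contDiffOn_succ_iff_derivWithin hU] at hcd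
    exact hcd.2.2.differentiableOn (by simp) r hr
  have := hu.equation φ r hr
  rw [iteratedDerivWithin_succ, iteratedDerivWithin_one, zero_mul, add_zero, sub_eq_zero]
    at this
  have h2 := hd.hasDerivWithinAt
  rw [this] at h2
  exact h2

end Cauchy

/-! ### Values of the kernels on the diagonal `r = τ`. -/

/-- The factor `(1 + τ) ^ (-im)`. -/
noncomputable def amplitude (m : ℂ) (τ : ℝ) : ℂ := ((1 + τ : ℝ) : ℂ) ^ (-(Complex.I * m))

theorem amplitude_zero (m : ℂ) : amplitude m 0 = 1 := by simp [amplitude]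

theorem hasDerivAt_amplitude (m : ℂ) {τ : ℝ} (hτ : -1 < τ) :
    HasDerivAt (amplitude m) (-(Complex.I * m) * amplitude m τ / (1 + τ)) τ := by
  have h0 : 0 < 1 + τ := by linarith
  have h : ((1 + τ : ℝ) : ℂ) ≠ 0 := by exact_mod_cast h0.ne'
  have h1 := ((hasDerivAt_id ((1 + τ : ℝ) : ℂ)).cpow_const (c := -(Complex.I * m))
    (Or.inl (by simpa using h0))).comp_of_eq τ (((hasDerivAt_id τ).const_add 1).ofReal_comp) rfl
  refine h1.congr_deriv ?_
  rw [id, Complex.cpow_sub _ _ h, Complex.cpow_one, amplitude]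
  push_cast
  ring

theorem two_cpow_mul_cpow_neg (m : ℂ) {τ : ℝ} (hτ : -1 < τ) :
    (2 : ℂ) ^ (2 * Complex.I * m) * ((4 * (1 + τ) : ℝ) : ℂ) ^ (-(Complex.I * m)) =
      amplitude m τ := by
  have h4 : ((4 * (1 + τ) : ℝ) : ℂ) = ((2 : ℝ) : ℂ) * (((2 : ℝ) : ℂ) * ((1 + τ : ℝ) : ℂ)) := by
    push_cast
    ring
  have h2 : (2 : ℂ) ≠ 0 := two_ne_zero
  have h5 : (0 : ℝ) ≤ 2 * (1 + τ) := by linarith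
  rw [h4, ← Complex.ofReal_mul 2 (1 + τ), Complex.mul_cpow_ofReal_nonneg zero_le_two h5,
    Complex.ofReal_mul, Complex.mul_cpow_ofReal_nonneg zero_le_two (by linarith), amplitude,
    ← mul_assoc, ← mul_assoc]
  rw [show 2 * Complex.I * m = Complex.I * m + Complex.I * m by ring, Complex.cpow_add _ _ h2,
    Complex.cpow_neg, Complex.ofReal_ofNat]
  have : (2 : ℂ) ^ (Complex.I * m) ≠ 0 := by simp [Complex.cpow_eq_zero_iff]
  field_simp

theorem kernelE_diag (m : ℂ) {τ : ℝ} (hτ : -1 < τ) : kernelE m τ τ 0 = amplitude m τ := by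
  rw [← two_cpow_mul_cpow_neg m hτ]
  simp only [kernelE, sub_zero, add_zero, sub_self, zero_div, Complex.ofReal_zero,
    Complex.ofReal_one, ordinaryHypergeometric_zero, mul_one, Complex.one_cpow]
  congr 3
  ring

/-- At `r = τ`, `b = 0` the argument of `F` vanishes, so only `F(0) = 1` and `F'(0) = (im)²` enter;
the latter is the Gauss equation at `z = 0`. -/
theorem hasDerivAt_kernelE_diag (m : ℂ) {τ : ℝ} (hτ : -1 < τ) :
    HasDerivAt (fun b => kernelE m τ τ b)
      (amplitude m τ * (2 * (Complex.I * m) -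
        Complex.I * m * (τ * (Complex.I * m) + τ + 2) / (2 * (1 + τ)))) 0 := by
  set μ := Complex.I * m with hμ
  have h0 : 0 < 1 + τ := by linarith
  have hne : (1 + τ : ℂ) ≠ 0 := by exact_mod_cast h0.ne'
  obtain ⟨hF, -, hode⟩ := hypergeometric_ode μ (z := 0) (by simp)
  have hF' : deriv (ordinaryHypergeometric (𝔸 := ℂ) μ μ (1 : ℂ)) 0 = μ ^ 2 := by
    rw [ordinaryHypergeometric_zero] at hode
    linear_combination hode
  have hz : ((((τ - 0) ^ 2 - τ ^ 2) / ((τ + 0 + 2) ^ 2 - τ ^ 2) : ℝ) : ℂ) = 0 := by simp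
  have hq : (τ + 0 + 2) ^ 2 - τ ^ 2 = 4 * (1 + τ) := by ring
  have h1 := HasDerivAt.homog (ν := μ) (f := ordinaryHypergeometric (𝔸 := ℂ) μ μ (1 : ℂ))
    (f' := μ ^ 2) (p := fun b => (τ - b) ^ 2 - τ ^ 2) (q := fun b => (τ + b + 2) ^ 2 - τ ^ 2)
    (p' := -2 * τ) (q' := 2 * (τ + 2)) (x := 0) (by rw [hz, ← hF']; exact hF)
    (((((hasDerivAt_id (0 : ℝ)).const_sub τ).pow 2).sub_const _).congr_deriv (by simp))
    ((((((hasDerivAt_id (0 : ℝ)).const_add τ).add_const 2).pow 2).sub_const _).congr_deriv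
      (by simp)) (by rw [hq]; linarith)
  have h2 := (((hasDerivAt_id ((1 + 0 : ℝ) : ℂ)).cpow_const (c := 2 * Complex.I * m)
    (Or.inl (by simp))).comp_of_eq 0 (((hasDerivAt_id (0 : ℝ)).const_add 1).ofReal_comp)
    rfl).const_mul ((2 : ℂ) ^ (2 * Complex.I * m))
  rw [hz, hq, ordinaryHypergeometric_zero] at h1
  simp only [kernelE_eq_homog]
  refine (h2.mul h1).congr_deriv ?_
  have ha := two_cpow_mul_cpow_neg m hτ
  have hhom : homog μ (ordinaryHypergeometric (𝔸 := ℂ) μ μ (1 : ℂ)) ((τ - 0) ^ 2 - τ ^ 2)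
      ((τ + 0 + 2) ^ 2 - τ ^ 2) = ((4 * (1 + τ) : ℝ) : ℂ) * ((4 * (1 + τ) : ℝ) : ℂ) ^ (-(μ + 1)) := by
    rw [homog, hz, hq, ordinaryHypergeometric_zero, mul_one, ofReal_cpow_neg_eq_mul (by linarith)]
  rw [ofReal_cpow_neg_eq_mul (by linarith : 0 < 4 * (1 + τ)), ← hμ] at ha
  rw [← ha, hhom]
  simp only [Function.comp_apply, id, add_zero, Complex.ofReal_one, Complex.one_cpow]
  generalize ((4 * (1 + τ) : ℝ) : ℂ) ^ (-(μ + 1)) = R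
  generalize (2 : ℂ) ^ (2 * Complex.I * m) = A
  rw [show 2 * Complex.I * m = 2 * μ by rw [hμ]; ring]
  push_cast
  field_simp
  ring

theorem isEPDKernel_kernelK1 (m : ℂ) : ∃ Kt Ktt Kr Krr,
    IsEPDKernel (fun τ => 2 * Complex.I * m / ((τ + 1 : ℝ) : ℂ)) (fun r τ => kernelK1 m r τ)
      Kt Ktt Kr Krr :=
  (isSmoothKernel_kernelE m).isEPDKernel

/-- The combination `K₀ + 2im K₁` agrees with an EPD kernel where that is smooth. -/
theorem exists_isEPDKernel_kernelK0 (m : ℂ) : ∃ K Kt Ktt Kr Krr,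
    IsEPDKernel (fun τ => 2 * Complex.I * m / ((τ + 1 : ℝ) : ℂ)) K Kt Ktt Kr Krr ∧
    ∀ r τ, (r, τ) ∈ sliceDomain →
      K r τ = kernelK0 m r τ + 2 * Complex.I * m * kernelK1 m r τ := by
  have hG := isSmoothKernel_kernelE m
  obtain ⟨Kt, Ktt, Kr, Krr, h⟩ :=
    -- `G + (2im - 1) G - ∂_b G = 2im G - ∂_b G`, which at `b = 0` is `2im K₁ + K₀`.
    ((hG.add_smul hG (2 * Complex.I * m - 1)).add_smul hG.dirDeriv_b (-1)).isEPDKernel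
  refine ⟨_, Kt, Ktt, Kr, Krr, h, fun r τ hr => ?_⟩
  have hd := (hasDerivAt_comp_line isOpen_kernelDomain hG.contDiffOn (hasDerivAt_line_b r τ 0)
    (mem_sliceDomain_iff.1 hr)).deriv
  simp only [kernelK0, kernelK1]
  rw [hd]
  ring

/-- The value of `K₀ + 2im K₁` at `r = τ`. -/
theorem kernelK0_diag (m : ℂ) {τ : ℝ} (hτ : -1 < τ) :
    kernelK0 m τ τ + 2 * Complex.I * m * kernelK1 m τ τ =
      amplitude m τ * (Complex.I * m * (τ * (Complex.I * m) + τ + 2) / (2 * (1 + τ))) := by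
  rw [kernelK0, kernelK1, (hasDerivAt_kernelE_diag m hτ).deriv, kernelE_diag m hτ]
  ring

theorem continuousOn_coeff (m : ℂ) :
    ContinuousOn (fun τ : ℝ => 2 * Complex.I * m / ((τ + 1 : ℝ) : ℂ)) (Ici 0) := by
  refine ContinuousOn.div continuousOn_const (by fun_prop) fun τ hτ => ?_
  have : (0 : ℝ) < τ + 1 := by linarith [mem_Ici.1 hτ]
  exact_mod_cast this.ne'

theorem hasDerivAt_congr_gt {f g : ℝ → ℂ} {f' : ℂ} {τ : ℝ} (hτ : -1 < τ)
    (hf : HasDerivAt f f' τ) (h : ∀ t, -1 < t → g t = f t) : HasDerivAt g f' τ :=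
  hf.congr_of_eventuallyEq ((lt_mem_nhds hτ).mono h)

/-! ### The two solutions of the Cauchy problem. -/

section Solutions

variable {n : ℕ} {Ω : Opens (Space n)} {T : Type*} [AddCommGroup T] [Module ℂ T]
  [TopologicalSpace T] {S : TestSpace Ω T} {At : 𝓓(Ω, ℂ) →L[ℂ] T} {g₀ : Distr Ω}
  {EA : ℝ → T →L[ℂ] ℂ}

/-- The Volterra integral against `K₁` has initial values `0`, `g₀`. -/
theorem solvesCauchy_kernelK1 {m : ℂ} (hEA : SolvesCauchy S At (fun _ => 0) g₀ 0 EA)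
    {E₁ : ℝ → T →L[ℂ] ℂ}
    (hE₁ : ∀ τ, 0 ≤ τ → IsWeakIntegral (fun r => kernelK1 m r τ) EA τ (E₁ τ))
    (hc : ∀ f : T, ContinuousOn (fun τ => E₁ τ f) (Ici 0)) :
    SolvesCauchy S At (fun τ => 2 * Complex.I * m / ((τ + 1 : ℝ) : ℂ)) 0 g₀ E₁ := by
  obtain ⟨Kt, Ktt, Kr, Krr, hK⟩ := isEPDKernel_kernelK1 m
  have hdiag (t : ℝ) (ht : -1 < t) : kernelK1 m t t = amplitude m t := kernelE_diag m ht
  refine solvesCauchy_of_hasDerivAt hc (continuousOn_coeff m) fun φ => ?_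
  obtain ⟨V₀, V₁, h0, h1, hV, hext⟩ := hEA.exists_even_extension φ
  have hc0 : Continuous V₀ := continuous_iff_continuousAt.2 fun r => (h0 r).continuousAt
  have hc2 : Continuous fun r : ℝ => EA |r| (At φ) :=
    (hEA.continuousOn (At φ)).comp_continuous continuous_abs fun r => abs_nonneg r
  have hV0 : V₀ 0 = g₀ φ := by
    rw [hext 0 le_rfl, ← hEA.initial]
    rfl
  refine ⟨fun t => ∫ r in (0 : ℝ)..t, kernelK1 m r t * V₀ r,
    fun t => kernelK1 m t t * V₀ t + ∫ r in (0 : ℝ)..t, Kt r t * V₀ r,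
    fun τ hτ => (hE₁ τ hτ).eq_integral hτ hext,
    fun τ hτ => hasDerivAt_volterra hK.cont hK.cont_t hK.deriv_t hc0 (by linarith),
    fun τ hτ => ?_, by simp, ?_⟩
  · have hτ' : -1 < τ := by linarith
    refine (hK.hasDerivAt_deriv_volterra h0 h1 hc2 hV hτ').congr_deriv ?_
    have hne : (1 + τ : ℂ) ≠ 0 := by
      have : 0 < 1 + τ := by linarith
      exact_mod_cast this.ne'
    -- `Kr + Kt` on the diagonal is the derivative of the amplitude, so the diagonal defect `2k' + c
    -- k` vanishes.
    have hk := (hK.deriv_diag τ hτ').unique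
      (hasDerivAt_congr_gt hτ' (hasDerivAt_amplitude m hτ') hdiag)
    beta_reduce
    rw [hk, hdiag τ hτ', (hE₁ τ hτ).eq_integral hτ
      (v := fun r => EA |r| (At φ)) fun r hr => by simp only [abs_of_nonneg hr]]
    push_cast
    rw [add_comm (τ : ℂ) 1]
    field_simp
    ring
  · simp [hdiag 0 (by norm_num), amplitude_zero, hV0]

/-- The amplitude times the wave solution plus the Volterra integral against `K₀ + 2im K₁` has
initial values `g₀`, `0`. -/
theorem solvesCauchy_kernelK0 {m : ℂ} (hEA : SolvesCauchy S At (fun _ => 0) g₀ 0 EA)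
    {I₀ : ℝ → T →L[ℂ] ℂ}
    (hI₀ : ∀ τ, 0 ≤ τ → IsWeakIntegral
      (fun r => kernelK0 m r τ + 2 * Complex.I * m * kernelK1 m r τ) EA τ (I₀ τ))
    (hc : ∀ f : T, ContinuousOn (fun τ => I₀ τ f) (Ici 0)) [IsTopologicalAddGroup T] :
    SolvesCauchy S At (fun τ => 2 * Complex.I * m / ((τ + 1 : ℝ) : ℂ)) g₀ 0
      (fun τ => amplitude m τ • EA τ + I₀ τ) := by
  obtain ⟨K, Kt, Ktt, Kr, Krr, hK, hKe⟩ := exists_isEPDKernel_kernelK0 m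
  have hdiag (t : ℝ) (ht : -1 < t) : K t t =
      amplitude m t * (Complex.I * m * (t * (Complex.I * m) + t + 2) / (2 * (1 + t))) := by
    rw [hKe t t (mem_sliceDomain_of_mem_uIcc ht right_mem_uIcc), kernelK0_diag m ht]
  have hI (τ : ℝ) (hτ : 0 ≤ τ) : IsWeakIntegral (fun r => K r τ) EA τ (I₀ τ) :=
    (hI₀ τ hτ).congr fun r hr =>
      (hKe r τ (mem_sliceDomain_of_mem_uIcc (by linarith) hr)).symm
  have hamp : ContinuousOn (amplitude m) (Ici 0) := fun τ hτ =>
    (hasDerivAt_amplitude m (by linarith [mem_Ici.1 hτ])).continuousAt.continuousWithinAt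
  refine solvesCauchy_of_hasDerivAt
    (fun f => (hamp.mul (hEA.continuousOn f)).add (hc f)) (continuousOn_coeff m) fun φ => ?_
  obtain ⟨V₀, V₁, h0, h1, hV, hext⟩ := hEA.exists_even_extension φ
  have hc0 : Continuous V₀ := continuous_iff_continuousAt.2 fun r => (h0 r).continuousAt
  have hc2 : Continuous fun r : ℝ => EA |r| (At φ) :=
    (hEA.continuousOn (At φ)).comp_continuous continuous_abs fun r => abs_nonneg r
  have hV0 : V₀ 0 = g₀ φ := by
    rw [hext 0 le_rfl, ← hEA.initial]
    rfl
  set μ := Complex.I * m with hμ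
  have hne (t : ℝ) (ht : -1 < t) : (1 + t : ℂ) ≠ 0 := by
    have : 0 < 1 + t := by linarith
    exact_mod_cast this.ne'
  refine ⟨fun t => amplitude m t * V₀ t + ∫ r in (0 : ℝ)..t, K r t * V₀ r,
    fun t => (-μ * amplitude m t / (1 + t) * V₀ t + amplitude m t * V₁ t) +
      (K t t * V₀ t + ∫ r in (0 : ℝ)..t, Kt r t * V₀ r),
    fun τ hτ => ?_, fun τ hτ => ?_, fun τ hτ => ?_, by simp [amplitude_zero, hV0], ?_⟩
  · beta_reduce
    rw [← (hI τ hτ).eq_integral hτ hext, hext τ hτ]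
    rfl
  · have hτ' : -1 < τ := by linarith
    exact ((hasDerivAt_amplitude m hτ').mul (h0 τ)).add
      (hasDerivAt_volterra hK.cont hK.cont_t hK.deriv_t hc0 hτ')
  · have hτ' : -1 < τ := by linarith
    have hn := hne τ hτ'
    have da := hasDerivAt_amplitude m hτ'
    have dl : HasDerivAt (fun t : ℝ => (1 + t : ℂ)) 1 τ :=
      (hasDerivAt_id τ).ofReal_comp.const_add 1
    have dn : HasDerivAt (fun t : ℝ => μ * (t * μ + t + 2)) (μ * (μ + 1)) τ :=
      (((((hasDerivAt_id τ).ofReal_comp.mul_const μ).add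
        (hasDerivAt_id τ).ofReal_comp).add_const 2).const_mul μ).congr_deriv (by simp)
    -- With `k = a h`, `2k' + c k = 2 a h' = μ (μ - 1) a / (1 + τ)²`, while `a'' + c a' = μ (1 - μ)
    -- a / (1 + τ)²`; these cancel in the final computation.
    have da1 := (da.const_mul (-μ)).div dl hn
    have dk := da.mul (dn.div (dl.const_mul 2) (mul_ne_zero two_ne_zero hn))
    have hk := (hK.deriv_diag τ hτ').unique (hasDerivAt_congr_gt hτ' dk hdiag)
    refine (((da1.mul (h0 τ)).add (da.mul (h1 τ))).add
      (hK.hasDerivAt_deriv_volterra h0 h1 hc2 hV hτ')).congr_deriv ?_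
    beta_reduce
    rw [hk, hdiag τ hτ']
    have hE : (amplitude m τ • EA τ + I₀ τ) (At φ) =
        amplitude m τ * EA |τ| (At φ) + ∫ r in (0 : ℝ)..τ, K r τ * EA |r| (At φ) := by
      rw [← (hI τ hτ).eq_integral hτ
        (f := At φ) (v := fun r => EA |r| (At φ)) fun r hr => by simp only [abs_of_nonneg hr],
        abs_of_nonneg hτ]
      rfl
    rw [hE, show 2 * Complex.I * m = 2 * μ by rw [hμ]; ring]
    simp only [← hμ]
    push_cast
    rw [add_comm (τ : ℂ) 1]
    simp only [Pi.div_apply]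
    field_simp
    ring
  -- The initial velocity is `(a'(0) + k(0)) V₀ 0` with `a'(0) = -μ` and `k(0) = μ`.
  · simp [hdiag 0 (by norm_num), amplitude_zero, hV, hμ]

end Solutions

end EPD

theorem mainTheorem6 {n : ℕ} (Ω : TopologicalSpace.Opens (EPD.Space n))
    {T : Type*} [AddCommGroup T] [Module ℂ T] [TopologicalSpace T] [IsTopologicalAddGroup T]
    [ContinuousSMul ℂ T] [BarrelledSpace ℂ T] (S : EPD.TestSpace Ω T)
    (a : EPD.Space n → EPD.Space n → ℂ) (ha : EPD.IsSymbol Ω a)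
    (At : 𝓓(Ω, ℂ) →L[ℂ] T) (hAt : EPD.IsTranspose S a At)
    (m : ℂ) (x₀ : EPD.Space n) (hx₀ : x₀ ∈ Ω)
    (EA : ℝ → T →L[ℂ] ℂ)
    (hEA : EPD.SolvesCauchy S At (fun _ => 0) (EPD.dirac Ω x₀) 0 EA) :
    ∃ I₀ E₀ E₁ : ℝ → T →L[ℂ] ℂ,
      (∀ τ : ℝ, 0 ≤ τ → EPD.IsWeakIntegral
        (fun r => EPD.kernelK0 m r τ + 2 * Complex.I * m * EPD.kernelK1 m r τ) EA τ (I₀ τ)) ∧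
      (∀ τ : ℝ, 0 ≤ τ →
        E₀ τ = ((1 + τ : ℝ) : ℂ) ^ (-(Complex.I * m)) • EA τ + I₀ τ) ∧
      (∀ τ : ℝ, 0 ≤ τ → EPD.IsWeakIntegral (fun r => EPD.kernelK1 m r τ) EA τ (E₁ τ)) ∧
      EPD.SolvesCauchy S At (fun τ => 2 * Complex.I * m / ((τ + 1 : ℝ) : ℂ))
        (EPD.dirac Ω x₀) 0 E₀ ∧
      EPD.SolvesCauchy S At (fun τ => 2 * Complex.I * m / ((τ + 1 : ℝ) : ℂ))
        0 (EPD.dirac Ω x₀) E₁ := by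
  obtain ⟨K, _, _, _, _, hK, hKe⟩ := EPD.exists_isEPDKernel_kernelK0 m
  obtain ⟨I₀, hI₀, hc₀⟩ := hK.exists_family hEA.continuousOn
  obtain ⟨_, _, _, _, hK₁⟩ := EPD.isEPDKernel_kernelK1 m
  obtain ⟨E₁, hE₁, hc₁⟩ := hK₁.exists_family hEA.continuousOn
  -- The smooth kernel `K` is known to equal `K₀ + 2im K₁` on `sliceDomain`, which contains the
  -- whole range of integration.
  have hI₀' (τ : ℝ) (hτ : 0 ≤ τ) := (hI₀ τ hτ).congr fun r hr =>
    hKe r τ (EPD.mem_sliceDomain_of_mem_uIcc (by linarith) hr)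
  exact ⟨I₀, fun τ => EPD.amplitude m τ • EA τ + I₀ τ, E₁, hI₀', fun _ _ => rfl, hE₁,
    EPD.solvesCauchy_kernelK0 hEA hI₀' hc₀, EPD.solvesCauchy_kernelK1 hEA hE₁ hc₁⟩
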